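/- For a point $p\in\mathbb R^2$ and a compact set $T\subseteq\mathbb R^2$ put $R_{T,p}(\theta)=\sup\{r\ge 0: p+r(\cos\theta,\sin\theta)\in T\}$. Call $\langle T,p\rangle$ a star-shaped domain if $T\subseteq\mathbb R^2$ is compact, $p$ is an interior point of $T$, for every $x\in T$ the segment from $p$ to $x$ is contained in $T$, and $\theta\mapsto R_{T,p}(\theta)$ (the distance from $p$ to $\partial T$ in direction $\theta$) is Lipschitz on $\mathbb R$. Let $\langle T,p\rangle$ be a star-shaped domain, and let $\langle T_1,p_1\rangle,\dots,\langle T_n,p_n\rangle$ be star-shaped domains with $T=\bigcup_i T_i$ and with pairwise disjoint interiors. Then there is a constant $C_1\in\mathbb R$ such that for every function $f:T\to(0,\infty)$ that is constant on the interior of each $T_i$ there is a biLipschitz homeomorphism $\phi:T\to T$ which fixes $\partial T$ pointwise and satisfies $$\operatorname{Jac}(\phi)=\det D_\phi=\frac{|T|}{\int_T f}\cdot f\quad\text{a.e. on }T,\qquad \operatorname{biLip}(\phi)\le\left(\frac{\max f}{\min f}\right)^{C_1}.$$ Here $|T|$ is the area of $T$, $\max f$ and $\min f$ are the largest and the smallest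 of the finitely many values that $f$ takes on $\bigcup_i \operatorname{int}(T_i)$, and $\operatorname{biLip}(\phi)\le L$ means that $\phi$ and $\phi^{-1}$ are both $L$-Lipschitz for the Euclidean distance. -/

import Mathlib

open MeasureTheory Set

noncomputable section

/-- The Euclidean plane. -/
abbrev Plane : Type := EuclideanSpace ℝ (Fin 2)

/-- The unit vector in direction `θ`. -/
def polarDir (θ : ℝ) : Plane := !₂[Real.cos θ, Real.sin θ]

/-- The radial function of `T` at `p`: the distance from `p` to the boundary of `T` in
direction `θ` (for `T` compact and star-shaped about `p`). -/
def radialFun (T : Set Plane) (p : Plane) (θ : ℝ) : ℝ :=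
  sSup {r : ℝ | 0 ≤ r ∧ p + r • polarDir θ ∈ T}

/-- `⟨T, p⟩` is a star-shaped domain: a compact set, with `p` in its interior, such that `p` sees
all of `T`. The regularity of the boundary is that the distance from `p` to the boundary is a
Lipschitz function of the direction; this holds in particular when the boundary is the polar graph
about `p` of a continuous, piecewise `C¹` function. -/
structure IsStarDomain (T : Set Plane) (p : Plane) : Prop where
  isCompact : IsCompact T
  mem_interior : p ∈ interior T
  segment_subset : ∀ x ∈ T, segment ℝ p x ⊆ T
  lipschitz_boundary : ∃ K : NNReal, LipschitzWith K (radialFun T p)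

/-- `T` is partitioned (tiled) into the sets `Ti i`: they cover `T`, lie in `T`, and have pairwise
disjoint interiors. -/
structure IsTilingOf {n : ℕ} (T : Set Plane) (Ti : Fin n → Set Plane) : Prop where
  iUnion_eq : ⋃ i, Ti i = T
  disjoint_interior : ∀ i j, i ≠ j → Disjoint (interior (Ti i)) (interior (Ti j))

/-- `φ` restricts to a biLipschitz homeomorphism of `T` onto itself with biLipschitz constant at
most `L`, i.e. `φ` and its inverse are `L`-Lipschitz on `T` for the Euclidean distance. -/
structure IsBiLipSelfMap (L : ℝ) (φ : Plane → Plane) (T : Set Plane) : Prop where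
  bijOn : BijOn φ T T
  upper : ∀ x ∈ T, ∀ y ∈ T, dist (φ x) (φ y) ≤ L * dist x y
  lower : ∀ x ∈ T, ∀ y ∈ T, dist x y ≤ L * dist (φ x) (φ y)

end

/-!
After dividing `f` by its minimum, the density on the tile `Tᵢ` is `1 + aᵢ` with `0 ≤ aᵢ ≤ ε`, where
`1 + ε = max f / min f`. A density is carried to another one by a homeomorphism whose determinant
is their quotient, and such homeomorphisms compose. The excess `aᵢ` of each tile is first
concentrated in a bump near the centre of the tile, by a map that is radial in the gauge of the
tile; the bumps are then moved one after the other to the centre of `T`; finally the total excess is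
spread evenly over `T`, again radially. To move a bump, mass is rearranged along parallel lines:
if two densities `ρ`, `ρ'` have the same integral on every line of direction `e`, then
`x ↦ x + d x • e` carries `ρ` to `ρ'` as soon as the mass of `ρ'` between `x` and `x + d x • e`
equals the excess of the mass of `ρ` over that of `ρ'` on the part of the line before `x`. Spreading
a bump in one direction, shifting it in the orthogonal direction and gathering it again takes three
such steps. Each step has biLipschitz constant at most `1 + C * ε ≤ (1 + ε) ^ max C 1`, or the
square of such a bound, with `C` depending only on the geometry. The value of the constant density
reached on `T` need not be computed: it is determined by `∫_T |det D φ| = |T|`.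
-/

open Filter Metric
open scoped NNReal Topology

/-! ### Transport of densities by biLipschitz homeomorphisms -/

section Transport

variable {E : Type*} [NormedAddCommGroup E] [NormedSpace ℝ E]

theorem det_fderiv_symm_mul_det_fderiv {φ : E ≃ E} {x : E} (hφ : DifferentiableAt ℝ φ x)
    (hψ : DifferentiableAt ℝ φ.symm (φ x)) :
    (fderiv ℝ φ.symm (φ x)).det * (fderiv ℝ φ x).det = 1 := by
  have hcomp : (fderiv ℝ φ.symm (φ x)).comp (fderiv ℝ φ x) = ContinuousLinearMap.id ℝ E := by
    rw [← fderiv_comp x hψ hφ, Equiv.symm_comp_self, fderiv_id]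
  simpa [ContinuousLinearMap.det, LinearMap.det_comp] using congrArg ContinuousLinearMap.det hcomp

variable [MeasurableSpace E] {μ : Measure E} {U V : Set E} {L L₁ L₂ : ℝ≥0} {ρ ρ₁ ρ₂ ρ₃ : E → ℝ}

/-- `φ` is a biLipschitz homeomorphism with constant `L`, equal to the identity off `U`, that
carries the density `ρ` to the density `ρ'`. The density equation is only required at almost every
point, where Rademacher's theorem provides the derivative. -/
structure IsTransport (μ : Measure E) (φ : E ≃ E) (U : Set E) (L : ℝ≥0) (ρ ρ' : E → ℝ) :
    Prop where
  lipschitz : LipschitzWith L φ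
  lipschitz_symm : LipschitzWith L φ.symm
  eq_off : ∀ x ∉ U, φ x = x
  jac : ∀ᵐ x ∂μ, DifferentiableAt ℝ φ x ∧ (fderiv ℝ φ x).det * ρ' (φ x) = ρ x

/-- Some biLipschitz homeomorphism with constant `L`, equal to the identity off `U`, carries the
density `ρ` to the density `ρ'`. -/
def Transportable (μ : Measure E) (U : Set E) (L : ℝ≥0) (ρ ρ' : E → ℝ) : Prop :=
  ∃ φ : E ≃ E, IsTransport μ φ U L ρ ρ'

theorem quasiMeasurePreserving_of_lipschitzWith_symm [FiniteDimensional ℝ E] [BorelSpace E]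
    [μ.IsAddHaarMeasure] {φ : E ≃ E} (hφ : Measurable φ) (hL : LipschitzWith L φ.symm) :
    Measure.QuasiMeasurePreserving φ μ μ := by
  refine ⟨hφ, Measure.AbsolutelyContinuous.mk fun N hN hμN => ?_⟩
  let H : Measure E := Measure.hausdorffMeasure (Module.finrank ℝ E)
  have hHN : H N = 0 := Measure.absolutelyContinuous_isAddHaarMeasure H μ hμN
  have himage := hL.hausdorffMeasure_image_le (d := Module.finrank ℝ E) (Nat.cast_nonneg _) N
  rw [hHN, mul_zero, nonpos_iff_eq_zero, Equiv.image_symm_eq_preimage] at himage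
  rw [Measure.map_apply hφ hN]
  exact Measure.absolutelyContinuous_isAddHaarMeasure μ H himage

theorem IsTransport.quasiMeasurePreserving [FiniteDimensional ℝ E] [BorelSpace E]
    [μ.IsAddHaarMeasure] {φ : E ≃ E} (h : IsTransport μ φ U L ρ₁ ρ₂) :
    Measure.QuasiMeasurePreserving φ μ μ :=
  quasiMeasurePreserving_of_lipschitzWith_symm h.lipschitz.continuous.measurable h.lipschitz_symm

namespace Transportable

theorem refl (μ : Measure E) (U : Set E) (ρ : E → ℝ) : Transportable μ U 1 ρ ρ :=
  ⟨Equiv.refl E, LipschitzWith.id, LipschitzWith.id, fun _ _ => rfl, .of_forall fun x => by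
    rw [Equiv.coe_refl, fderiv_id]
    exact ⟨differentiableAt_id, by simp [ContinuousLinearMap.det]⟩⟩

theorem mono (h : Transportable μ U L₁ ρ₁ ρ₂) (hL : L₁ ≤ L₂) (hU : U ⊆ V) :
    Transportable μ V L₂ ρ₁ ρ₂ := by
  obtain ⟨φ, h⟩ := h
  exact ⟨φ, h.lipschitz.weaken hL, h.lipschitz_symm.weaken hL,
    fun x hx => h.eq_off x fun hxU => hx (hU hxU), h.jac⟩

variable [FiniteDimensional ℝ E] [BorelSpace E] [μ.IsAddHaarMeasure]

theorem symm (h : Transportable μ U L ρ₁ ρ₂) : Transportable μ U L ρ₂ ρ₁ := by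
  obtain ⟨φ, h⟩ := h
  refine ⟨φ.symm, h.lipschitz_symm, h.lipschitz, fun x hx => ?_, ?_⟩
  · rw [Equiv.symm_apply_eq, h.eq_off x hx]
  have hsymm : Measure.QuasiMeasurePreserving φ.symm μ μ :=
    quasiMeasurePreserving_of_lipschitzWith_symm h.lipschitz_symm.continuous.measurable h.lipschitz
  filter_upwards [h.lipschitz_symm.ae_differentiableAt (μ := μ), hsymm.ae h.jac]
    with y hψ ⟨hφ, hdet⟩
  have hinv := det_fderiv_symm_mul_det_fderiv hφ (by simpa using hψ)
  rw [φ.apply_symm_apply] at hdet hinv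
  exact ⟨hψ, by rw [← hdet, ← mul_assoc, hinv, one_mul]⟩

theorem trans (h₁ : Transportable μ U L₁ ρ₁ ρ₂) (h₂ : Transportable μ U L₂ ρ₂ ρ₃) :
    Transportable μ U (L₂ * L₁) ρ₁ ρ₃ := by
  obtain ⟨φ, h₁⟩ := h₁
  obtain ⟨ψ, h₂⟩ := h₂
  refine ⟨φ.trans ψ, h₂.lipschitz.comp h₁.lipschitz, ?_, fun x hx => ?_, ?_⟩
  · rw [mul_comm]
    exact h₁.lipschitz_symm.comp h₂.lipschitz_symm
  · rw [Equiv.trans_apply, h₁.eq_off x hx, h₂.eq_off x hx]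
  filter_upwards [h₁.quasiMeasurePreserving.ae h₂.jac, h₁.jac] with x ⟨hψ, hψdet⟩ ⟨hφ, hφdet⟩
  rw [Equiv.coe_trans]
  refine ⟨hψ.comp x hφ, ?_⟩
  rw [fderiv_comp x hψ hφ, ← hφdet, ← hψdet]
  simp only [ContinuousLinearMap.det, ContinuousLinearMap.toLinearMap_comp, LinearMap.det_comp,
    Function.comp_apply]
  ring

theorem trans_rpow {ε : ℝ≥0} {k₁ k₂ : ℝ} (h₁ : Transportable μ U ((1 + ε) ^ k₁) ρ₁ ρ₂)
    (h₂ : Transportable μ U ((1 + ε) ^ k₂) ρ₂ ρ₃) :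
    Transportable μ U ((1 + ε) ^ (k₁ + k₂)) ρ₁ ρ₃ := by
  rw [add_comm k₁, NNReal.rpow_add (by positivity)]
  exact h₁.trans h₂

end Transportable

end Transport

theorem one_add_mul_le_rpow (C ε : ℝ≥0) : 1 + C * ε ≤ (1 + ε) ^ (max C 1 : ℝ) := by
  rw [← NNReal.coe_le_coe]
  push_cast
  calc (1 : ℝ) + C * ε ≤ 1 + max (C : ℝ) 1 * ε := by gcongr; exact le_max_left _ _
    _ ≤ (1 + ε) ^ max (C : ℝ) 1 :=
      one_add_mul_self_le_rpow_one_add (by linarith [ε.coe_nonneg]) (le_max_right _ _)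

/-! ### Radial gauges -/

section RadialGauge

variable {E : Type*} [NormedAddCommGroup E] [NormedSpace ℝ E] {g : E → ℝ} {p : E} {K R : ℝ≥0}

/-- `g` is a gauge about `p`: a `K`-Lipschitz function, positively homogeneous about `p`, whose
unit sublevel set `{x | g x ≤ 1}` lies in the ball of radius `R` about `p`. The gauges of Lipschitz
star-shaped domains about their centre are of this kind. -/
structure IsRadialGauge (g : E → ℝ) (p : E) (K R : ℝ≥0) : Prop where
  lipschitz : LipschitzWith K g
  map_add_smul : ∀ t : ℝ, 0 ≤ t → ∀ v, g (p + t • v) = t * g (p + v)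
  dist_le : ∀ x, dist x p ≤ R * g x

namespace IsRadialGauge

theorem continuous (hg : IsRadialGauge g p K R) : Continuous g := hg.lipschitz.continuous

theorem map_center (hg : IsRadialGauge g p K R) : g p = 0 := by
  simpa using hg.map_add_smul 0 le_rfl 0

theorem nonneg (hg : IsRadialGauge g p K R) (x : E) : 0 ≤ g x := by
  by_contra! hx
  have hdist : dist x p ≤ 0 :=
    (hg.dist_le x).trans (mul_nonpos_of_nonneg_of_nonpos R.coe_nonneg hx.le)
  rw [dist_le_zero.1 hdist, hg.map_center] at hx
  exact lt_irrefl 0 hx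

theorem pos (hg : IsRadialGauge g p K R) {x : E} (hx : x ≠ p) : 0 < g x :=
  pos_of_mul_pos_right ((dist_pos.2 hx).trans_le (hg.dist_le x)) R.coe_nonneg

theorem isOpen_lt (hg : IsRadialGauge g p K R) : IsOpen {x | g x < 1} :=
  _root_.isOpen_lt hg.continuous continuous_const

theorem interior_sublevel (hg : IsRadialGauge g p K R) :
    interior {x | g x ≤ 1} = {x | g x < 1} := by
  refine Subset.antisymm (fun x hx => ?_)
    (interior_maximal (fun x (hx : g x < 1) => hx.le) hg.isOpen_lt)
  have hle := interior_subset hx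
  rw [mem_ofPred_eq] at hle ⊢
  refine hle.lt_of_ne fun hgx => ?_
  have hray : Tendsto (fun t : ℝ => p + t • (x - p)) (𝓝[>] 1) (𝓝 x) :=
    tendsto_nhdsWithin_of_tendsto_nhds <| by
      simpa using Continuous.tendsto (f := fun t : ℝ => p + t • (x - p)) (by fun_prop) 1
  obtain ⟨t, hgt, ht⟩ := ((hray.eventually (mem_interior_iff_mem_nhds.1 hx)).and
    self_mem_nhdsWithin).exists
  rw [hg.map_add_smul t (zero_le_one.trans ht.le), add_sub_cancel, hgx, mul_one] at hgt
  exact hgt.not_gt ht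

theorem fderiv_apply_sub (hg : IsRadialGauge g p K R) {x : E} (hx : DifferentiableAt ℝ g x) :
    fderiv ℝ g x (x - p) = g x := by
  have hray : HasDerivAt (fun t : ℝ => p + t • (x - p)) (x - p) 1 := by
    simpa using ((hasDerivAt_id (1 : ℝ)).smul_const (x - p)).const_add p
  have hgray : HasDerivAt (fun t : ℝ => g (p + t • (x - p))) (fderiv ℝ g x (x - p)) 1 :=
    HasFDerivAt.comp_hasDerivAt (1 : ℝ) (by simpa using hx.hasFDerivAt) hray
  have hlinear : HasDerivAt (fun t : ℝ => t * g x) (g x) 1 := by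
    simpa using (hasDerivAt_id (1 : ℝ)).mul_const (g x)
  refine hgray.unique (hlinear.congr_of_eventuallyEq ?_)
  filter_upwards [lt_mem_nhds (zero_lt_one : (0 : ℝ) < 1)] with t ht
  rw [hg.map_add_smul t ht.le, add_sub_cancel]

variable [MeasurableSpace E] [BorelSpace E] [FiniteDimensional ℝ E] (μ : Measure E)
  [μ.IsAddHaarMeasure]

theorem measure_level_eq_zero (hg : IsRadialGauge g p K R) {s : ℝ} (hs : 0 < s) :
    μ {x | g x = s} = 0 := by
  -- Only countably many level sets have positive measure, and all are homothetic to each other.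
  obtain ⟨t, ht, hμt⟩ : ∃ t : ℝ, 0 < t ∧ ¬0 < μ {x | g x = t} := by
    by_contra! hpos
    have hcount := Measure.countable_meas_level_set_pos (μ := μ) hg.continuous.measurable
    have hnull := (hcount.mono (s₁ := Ioi 0) hpos).measure_zero (volume : Measure ℝ)
    rw [Real.volume_Ioi] at hnull
    exact ENNReal.top_ne_zero hnull
  have hsub : {x | g x = s} ⊆ AffineMap.homothety p (s / t) '' {x | g x = t} := by
    rintro x (hx : g x = s)
    refine ⟨p + (t / s) • (x - p), ?_, ?_⟩
    · change g _ = t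
      rw [hg.map_add_smul _ (by positivity), add_sub_cancel, hx, div_mul_cancel₀ _ hs.ne']
    · rw [AffineMap.homothety_apply, vsub_eq_sub, add_sub_cancel_left, vadd_eq_add, smul_smul,
        div_mul_div_cancel₀ ht.ne', div_self hs.ne', one_smul, sub_add_cancel]
  refine measure_mono_null hsub ?_
  rw [Measure.addHaar_image_homothety, nonpos_iff_eq_zero.1 (not_lt.1 hμt), mul_zero]

theorem ae_ne (hg : IsRadialGauge g p K R) {s : ℝ} (hs : 0 < s) : ∀ᵐ x ∂μ, g x ≠ s := by
  rw [ae_iff]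
  simpa using hg.measure_level_eq_zero μ hs

end IsRadialGauge

end RadialGauge

/-! ### The gauge of a star-shaped domain -/

section StarGauge

/-- The identification of the complex plane with the Euclidean plane. -/
noncomputable abbrev complexToPlane : ℂ ≃ₗᵢ[ℝ] Plane := Complex.orthonormalBasisOneI.repr

/-- The polar angle of a vector. -/
noncomputable def planeArg (v : Plane) : ℝ := (complexToPlane.symm v).arg

theorem polarDir_eq (θ : ℝ) : polarDir θ = complexToPlane (Complex.exp (θ * Complex.I)) := by
  ext i
  fin_cases i <;> simp [polarDir, Complex.exp_ofReal_mul_I_re, Complex.exp_ofReal_mul_I_im]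

theorem norm_polarDir (θ : ℝ) : ‖polarDir θ‖ = 1 := by
  rw [polarDir_eq, LinearIsometryEquiv.norm_map, Complex.norm_exp_ofReal_mul_I]

theorem norm_smul_polarDir (r θ : ℝ) : ‖r • polarDir θ‖ = |r| := by
  rw [norm_smul, norm_polarDir, mul_one, Real.norm_eq_abs]

theorem polarDir_periodic : Function.Periodic polarDir (2 * Real.pi) := fun θ => by
  simp [polarDir]

theorem norm_smul_polarDir_planeArg (v : Plane) : ‖v‖ • polarDir (planeArg v) = v := by
  rw [polarDir_eq, planeArg, ← map_smul, ← LinearIsometryEquiv.norm_map complexToPlane.symm,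
    Complex.real_smul, Complex.norm_mul_exp_arg_mul_I, LinearIsometryEquiv.apply_symm_apply]

theorem planeArg_smul {t : ℝ} (ht : 0 < t) (v : Plane) : planeArg (t • v) = planeArg v := by
  rw [planeArg, map_smul, Complex.real_smul, Complex.arg_real_mul _ ht, planeArg]

theorem norm_mul_norm_polarDir_sub_le (v w : Plane) :
    ‖w‖ * ‖polarDir (planeArg v) - polarDir (planeArg w)‖ ≤ 2 * ‖v - w‖ := by
  have hsplit : ‖w‖ • (polarDir (planeArg v) - polarDir (planeArg w))
      = (v - w) - (‖v‖ - ‖w‖) • polarDir (planeArg v) := by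
    rw [smul_sub, sub_smul, norm_smul_polarDir_planeArg, norm_smul_polarDir_planeArg]
    abel
  calc ‖w‖ * ‖polarDir (planeArg v) - polarDir (planeArg w)‖
      = ‖(v - w) - (‖v‖ - ‖w‖) • polarDir (planeArg v)‖ := by
        rw [← hsplit, norm_smul, norm_norm]
    _ ≤ ‖v - w‖ + ‖(‖v‖ - ‖w‖) • polarDir (planeArg v)‖ := norm_sub_le _ _
    _ ≤ ‖v - w‖ + ‖v - w‖ := by
        rw [norm_smul_polarDir]
        gcongr
        exact abs_norm_sub_norm_le v w
    _ = 2 * ‖v - w‖ := by ring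

theorem abs_sub_le_norm_polarDir_sub {F : ℝ → ℝ} {K : ℝ≥0} (hF : LipschitzWith K F)
    (hper : Function.Periodic F (2 * Real.pi)) (a b : ℝ) :
    |F a - F b| ≤ K * (Real.pi / 2 * ‖polarDir a - polarDir b‖) := by
  set δ := (Complex.exp ((a - b : ℝ) * Complex.I)).arg with hδ
  have hFδ : F (b + δ) = F a := by
    rw [hδ, Complex.arg_exp_mul_I, toIocMod, add_sub_assoc', add_sub_cancel, hper.sub_zsmul_eq]
  have hchord : |δ| ≤ Real.pi / 2 * ‖polarDir a - polarDir b‖ := by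
    have hdiv : Complex.exp ((a - b : ℝ) * Complex.I)
        = Complex.exp (a * Complex.I) / Complex.exp (b * Complex.I) := by
      rw [← Complex.exp_sub]
      push_cast
      ring_nf
    rw [hδ, hdiv, ← Complex.angle_eq_abs_arg (Complex.exp_ne_zero _) (Complex.exp_ne_zero _),
      polarDir_eq, polarDir_eq, ← map_sub, LinearIsometryEquiv.norm_map]
    exact Complex.angle_le_mul_norm_sub (Complex.norm_exp_ofReal_mul_I a)
      (Complex.norm_exp_ofReal_mul_I b)
  calc |F a - F b| ≤ K * |b + δ - b| := by
        rw [← hFδ]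
        exact hF.dist_le_mul (b + δ) b
    _ ≤ K * (Real.pi / 2 * ‖polarDir a - polarDir b‖) := by
        rw [add_sub_cancel_left]
        gcongr

/-- The gauge of `T` about `p`: the ratio of the distance to `p` and the radial function. -/
noncomputable def starGauge (T : Set Plane) (p x : Plane) : ℝ :=
  dist x p / radialFun T p (planeArg (x - p))

namespace IsStarDomain

variable {T : Set Plane} {p : Plane}

theorem isCompact_radii (hT : IsStarDomain T p) (θ : ℝ) :
    IsCompact {r : ℝ | 0 ≤ r ∧ p + r • polarDir θ ∈ T} := by
  refine Metric.isCompact_of_isClosed_isBounded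
    (isClosed_Ici.inter (hT.isCompact.isClosed.preimage (by fun_prop))) ?_
  obtain ⟨R, hR⟩ := hT.isCompact.isBounded.subset_closedBall p
  refine (Metric.isBounded_Icc (0 : ℝ) R).subset fun r ⟨hr, hrT⟩ => ⟨hr, ?_⟩
  simpa [norm_smul_polarDir, abs_of_nonneg hr] using hR hrT

theorem add_smul_polarDir_mem_iff (hT : IsStarDomain T p) (θ : ℝ) {r : ℝ} (hr : 0 ≤ r) :
    p + r • polarDir θ ∈ T ↔ r ≤ radialFun T p θ := by
  have hcompact := hT.isCompact_radii θ
  refine ⟨fun h => le_csSup hcompact.bddAbove ⟨hr, h⟩, fun h => ?_⟩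
  obtain ⟨hmax0, hmaxT⟩ : 0 ≤ radialFun T p θ ∧ p + radialFun T p θ • polarDir θ ∈ T :=
    hcompact.sSup_mem ⟨0, le_rfl, by simpa using interior_subset hT.mem_interior⟩
  have hseg := hT.segment_subset _ hmaxT
  rw [segment_eq_image'] at hseg
  refine hseg ⟨r / radialFun T p θ, ⟨by positivity, div_le_one_of_le₀ h hmax0⟩, ?_⟩
  rcases hmax0.eq_or_lt with hmax | hmax
  · simp [← hmax, le_antisymm (h.trans hmax.ge) hr]
  · simp only [add_sub_cancel_left, smul_smul, div_mul_cancel₀ _ hmax.ne']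

theorem exists_radialFun_bounds (hT : IsStarDomain T p) :
    ∃ r R : ℝ≥0, 0 < r ∧ ∀ θ, r ≤ radialFun T p θ ∧ radialFun T p θ ≤ R := by
  obtain ⟨r, hr, hrT⟩ := Metric.nhds_basis_closedBall.mem_iff.1
    (mem_interior_iff_mem_nhds.1 hT.mem_interior)
  obtain ⟨R, hR⟩ := hT.isCompact.isBounded.subset_closedBall p
  refine ⟨⟨r, hr.le⟩, R.toNNReal, hr, fun θ => ?_⟩
  have hrad : r ≤ radialFun T p θ := (hT.add_smul_polarDir_mem_iff θ hr.le).1 <| hrT <| by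
    simp [norm_smul_polarDir, abs_of_pos hr]
  have hmem := hR ((hT.add_smul_polarDir_mem_iff θ (hr.le.trans hrad)).2 le_rfl)
  refine ⟨hrad, le_trans ?_ (Real.le_coe_toNNReal R)⟩
  simpa [norm_smul_polarDir, abs_of_nonneg (hr.le.trans hrad)] using hmem

theorem lipschitzWith_starGauge {K r : ℝ≥0} (hr : 0 < r) (hK : LipschitzWith K (radialFun T p))
    (hrad : ∀ θ, r ≤ radialFun T p θ) :
    LipschitzWith (1 / r + K * Real.pi.toNNReal / (r * r)) (starGauge T p) := by
  have hpos : ∀ θ, 0 < radialFun T p θ := fun θ => (NNReal.coe_pos.2 hr).trans_le (hrad θ)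
  have hper : Function.Periodic (radialFun T p) (2 * Real.pi) := fun θ => by
    simp only [radialFun, polarDir_periodic θ]
  refine LipschitzWith.of_dist_le_mul fun x y => ?_
  set a := planeArg (x - p)
  set b := planeArg (y - p)
  set A := radialFun T p a
  set B := radialFun T p b
  have hA : 0 < A := hpos a
  have hB : 0 < B := hpos b
  have hdist : |dist x p - dist y p| ≤ dist x y := by
    simpa [dist_comm] using abs_dist_sub_le x y p
  have hdir : dist y p * |A - B| ≤ K * Real.pi * dist x y :=
    calc dist y p * |A - B|
        ≤ ‖y - p‖ * (K * (Real.pi / 2 * ‖polarDir a - polarDir b‖)) := by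
          rw [dist_eq_norm]
          gcongr
          exact abs_sub_le_norm_polarDir_sub hK hper a b
      _ = K * (Real.pi / 2) * (‖y - p‖ * ‖polarDir a - polarDir b‖) := by ring
      _ ≤ K * (Real.pi / 2) * (2 * ‖(x - p) - (y - p)‖) :=
          mul_le_mul_of_nonneg_left (norm_mul_norm_polarDir_sub_le _ _) (by positivity)
      _ = K * Real.pi * dist x y := by rw [sub_sub_sub_cancel_right, dist_eq_norm]; ring
  calc dist (starGauge T p x) (starGauge T p y) = |dist x p / A - dist y p / B| := rfl
    _ = |(dist x p - dist y p) / A - dist y p * (A - B) / (A * B)| := by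
        congr 1
        field_simp
        ring
    _ ≤ |dist x p - dist y p| / A + dist y p * |A - B| / (A * B) := by
        refine (abs_sub _ _).trans_eq ?_
        rw [abs_div, abs_div, abs_mul, abs_of_pos hA, abs_of_pos (mul_pos hA hB),
          abs_of_nonneg dist_nonneg]
    _ ≤ dist x y / r + K * Real.pi * dist x y / (r * r) := by
        gcongr
        exacts [hrad a, hrad a, hrad b]
    _ = (1 / r + K * Real.pi.toNNReal / (r * r) : ℝ≥0) * dist x y := by
        push_cast
        rw [Real.coe_toNNReal _ Real.pi_nonneg]
        ring

theorem exists_isRadialGauge (hT : IsStarDomain T p) :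
    ∃ K R, IsRadialGauge (starGauge T p) p K R := by
  obtain ⟨r, R, hr, hrad⟩ := hT.exists_radialFun_bounds
  obtain ⟨K, hK⟩ := hT.lipschitz_boundary
  refine ⟨_, R, lipschitzWith_starGauge hr hK fun θ => (hrad θ).1, fun t ht v => ?_, fun x => ?_⟩
  · rcases ht.eq_or_lt with rfl | ht
    · simp [starGauge]
    · simp only [starGauge, add_sub_cancel_left, planeArg_smul ht, dist_eq_norm, norm_smul,
        Real.norm_eq_abs, abs_of_pos ht, mul_div_assoc]
  · obtain ⟨hlower, hupper⟩ := hrad (planeArg (x - p))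
    rw [starGauge, mul_div_assoc', le_div_iff₀ ((NNReal.coe_pos.2 hr).trans_le hlower), mul_comm]
    gcongr

theorem setOf_starGauge_le (hT : IsStarDomain T p) : {x | starGauge T p x ≤ 1} = T := by
  ext x
  obtain ⟨r, R, hr, hrad⟩ := hT.exists_radialFun_bounds
  have hmem := hT.add_smul_polarDir_mem_iff (planeArg (x - p)) (norm_nonneg (x - p))
  rw [norm_smul_polarDir_planeArg, add_sub_cancel] at hmem
  rw [hmem, mem_ofPred_eq, starGauge, div_le_one ((NNReal.coe_pos.2 hr).trans_le (hrad _).1),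
    dist_eq_norm]

theorem setOf_starGauge_lt (hT : IsStarDomain T p) : {x | starGauge T p x < 1} = interior T := by
  obtain ⟨K, R, hg⟩ := hT.exists_isRadialGauge
  rw [← hg.interior_sublevel, hT.setOf_starGauge_le]

theorem volume_frontier (hT : IsStarDomain T p) : volume (frontier T) = 0 := by
  obtain ⟨K, R, hg⟩ := hT.exists_isRadialGauge
  refine measure_mono_null (fun x hx => ?_) (hg.measure_level_eq_zero volume one_pos)
  rw [hT.isCompact.isClosed.frontier_eq, ← hT.setOf_starGauge_lt] at hx
  exact le_antisymm (hT.setOf_starGauge_le.ge hx.1) (not_lt.1 hx.2)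

end IsStarDomain

end StarGauge

/-! ### Radial maps -/

theorem det_smul_id_add_smulRight {E : Type*} [NormedAddCommGroup E] [NormedSpace ℝ E]
    [FiniteDimensional ℝ E] {c : ℝ} (hc : c ≠ 0) (ℓ : E →L[ℝ] ℝ) (v : E) :
    (c • ContinuousLinearMap.id ℝ E + ℓ.smulRight v).det
      = c ^ Module.finrank ℝ E * (1 + c⁻¹ * ℓ v) := by
  have htrans : ((c • ContinuousLinearMap.id ℝ E + ℓ.smulRight v : E →L[ℝ] E) : E →ₗ[ℝ] E)
      = c • LinearMap.transvection (c⁻¹ • (ℓ : E →ₗ[ℝ] ℝ)) v := by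
    ext x
    simp [LinearMap.transvection.apply, smul_smul, hc]
  rw [ContinuousLinearMap.det, htrans, LinearMap.det_smul, LinearMap.transvection.det]
  simp

section RadialMap

variable {E : Type*} [NormedAddCommGroup E] [NormedSpace ℝ E] {g : E → ℝ} {p : E} {K R : ℝ≥0}
  {w : ℝ → ℝ} {D N : ℝ≥0}

/-- `w` is the stretching factor, as a function of the gauge, of a radial homeomorphism of the unit
sublevel set: `t * w t` is the gauge of the image of a point of gauge `t`. -/
structure IsRadialStretch (w : ℝ → ℝ) (D N : ℝ≥0) : Prop where
  one_le : ∀ t ∈ Icc (0 : ℝ) 1, 1 ≤ w t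
  map_one : w 1 = 1
  lipschitz : LipschitzOnWith D w (Icc 0 1)
  sub_le : ∀ s t : ℝ, 0 ≤ s → s ≤ t → t ≤ 1 → t - s ≤ N * (t * w t - s * w s)

/-- The radial map about `p` with stretching factor `w (g y)` at the points `y` with `g y ≤ 1`, and
with stretching factor `w 1` further out. -/
def radialMap (g : E → ℝ) (p : E) (w : ℝ → ℝ) (y : E) : E := p + w (min (g y) 1) • (y - p)

theorem IsRadialStretch.abs_sub_le (hw : IsRadialStretch w D N) {s t : ℝ} (hs : s ∈ Icc 0 1)
    (ht : t ∈ Icc 0 1) : |t - s| ≤ N * |t * w t - s * w s| := by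
  wlog hst : s ≤ t generalizing s t with H
  · rw [abs_sub_comm, abs_sub_comm (t * w t)]
    exact H ht hs (le_of_not_ge hst)
  rw [abs_of_nonneg (sub_nonneg.2 hst)]
  refine (hw.sub_le s t hs.1 hst ht.2).trans ?_
  gcongr
  exact le_abs_self _

theorem IsRadialStretch.mul_lt_one (hw : IsRadialStretch w D N) {t : ℝ} (ht0 : 0 ≤ t)
    (ht1 : t < 1) : t * w t < 1 := by
  have hgap := hw.sub_le t 1 ht0 ht1.le le_rfl
  rw [hw.map_one, mul_one] at hgap
  exact sub_pos.1 (pos_of_mul_pos_right ((sub_pos.2 ht1).trans_le hgap) N.coe_nonneg)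

theorem radialMap_of_one_le (hw : w 1 = 1) {y : E} (hy : 1 ≤ g y) : radialMap g p w y = y := by
  rw [radialMap, min_eq_right hy, hw, one_smul, add_sub_cancel]

namespace IsRadialGauge

theorem min_one_mem_Icc (hg : IsRadialGauge g p K R) (y : E) : min (g y) 1 ∈ Icc (0 : ℝ) 1 :=
  ⟨le_min (hg.nonneg y) zero_le_one, min_le_right _ _⟩

theorem abs_min_one_sub_le (hg : IsRadialGauge g p K R) (x y : E) :
    |min (g x) 1 - min (g y) 1| ≤ K * dist x y := by
  simpa [Real.dist_eq] using (hg.lipschitz.min_const 1).dist_le_mul x y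

theorem map_radialMap (hg : IsRadialGauge g p K R) (hw : IsRadialStretch w D N) (y : E) :
    g (radialMap g p w y) = w (min (g y) 1) * g y := by
  rw [radialMap, hg.map_add_smul _ (zero_le_one.trans (hw.one_le _ (hg.min_one_mem_Icc y))),
    add_sub_cancel]

theorem min_map_radialMap_one (hg : IsRadialGauge g p K R) (hw : IsRadialStretch w D N) (y : E) :
    min (g (radialMap g p w y)) 1 = min (g y) 1 * w (min (g y) 1) := by
  rw [hg.map_radialMap hw]
  rcases lt_or_ge (g y) 1 with hy | hy
  · rw [min_eq_left hy.le, mul_comm, min_eq_left (hw.mul_lt_one (hg.nonneg y) hy).le]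
  · rw [min_eq_right hy, hw.map_one, one_mul, one_mul, min_eq_right hy]

theorem map_radialMap_lt_one (hg : IsRadialGauge g p K R) (hw : IsRadialStretch w D N) {y : E}
    (hy : g y < 1) : g (radialMap g p w y) < 1 := by
  rw [hg.map_radialMap hw, min_eq_left hy.le, mul_comm]
  exact hw.mul_lt_one (hg.nonneg y) hy

theorem abs_stretch_sub_mul_dist_le (hg : IsRadialGauge g p K R) (hw : IsRadialStretch w D N)
    {x y : E} (hxy : g y ≤ g x) : |w (min (g x) 1) - w (min (g y) 1)| * dist y p
      ≤ D * R * |min (g x) 1 - min (g y) 1| := by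
  rcases le_total (g y) 1 with hy | hy
  · have hlip := hw.lipschitz.dist_le_mul _ (hg.min_one_mem_Icc x) _ (hg.min_one_mem_Icc y)
    rw [Real.dist_eq, Real.dist_eq] at hlip
    calc |w (min (g x) 1) - w (min (g y) 1)| * dist y p
        ≤ D * |min (g x) 1 - min (g y) 1| * R := by
          gcongr
          exact (hg.dist_le y).trans (mul_le_of_le_one_right R.coe_nonneg hy)
      _ = _ := by ring
  · rw [min_eq_right hy, min_eq_right (hy.trans hxy), sub_self, abs_zero, zero_mul, sub_self,
      abs_zero, mul_zero]

theorem radialMap_sub_radialMap (g : E → ℝ) (p : E) (w : ℝ → ℝ) (x y : E) :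
    radialMap g p w x - radialMap g p w y = w (min (g x) 1) • (x - y)
      + (w (min (g x) 1) - w (min (g y) 1)) • (y - p) := by
  rw [radialMap, radialMap]
  module

theorem lipschitzWith_radialMap (hg : IsRadialGauge g p K R) (hw : IsRadialStretch w D N) :
    LipschitzWith (1 + D * (1 + R * K)) (radialMap g p w) := by
  refine LipschitzWith.of_dist_le_mul fun x y => ?_
  wlog hxy : g y ≤ g x generalizing x y with H
  · rw [dist_comm, dist_comm x]
    exact H y x (le_of_not_ge hxy)
  have hmem := hg.min_one_mem_Icc x
  have hbound : |w (min (g x) 1)| ≤ 1 + D := by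
    have hlip := hw.lipschitz.dist_le_mul _ hmem 1 (right_mem_Icc.2 zero_le_one)
    rw [hw.map_one, Real.dist_eq, Real.dist_eq] at hlip
    calc |w (min (g x) 1)| = |(w (min (g x) 1) - 1) + 1| := by rw [sub_add_cancel]
      _ ≤ |w (min (g x) 1) - 1| + |1| := abs_add_le _ _
      _ ≤ D * 1 + 1 := by
          rw [abs_one]
          refine add_le_add_left (hlip.trans ?_) 1
          gcongr
          rw [abs_le]
          constructor <;> linarith [hmem.1, hmem.2]
      _ = 1 + D := by ring
  calc dist (radialMap g p w x) (radialMap g p w y)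
      ≤ ‖w (min (g x) 1) • (x - y)‖ + ‖(w (min (g x) 1) - w (min (g y) 1)) • (y - p)‖ := by
        rw [dist_eq_norm, radialMap_sub_radialMap]
        exact norm_add_le _ _
    _ = |w (min (g x) 1)| * dist x y + |w (min (g x) 1) - w (min (g y) 1)| * dist y p := by
        rw [norm_smul, norm_smul, Real.norm_eq_abs, Real.norm_eq_abs, dist_eq_norm, dist_eq_norm]
    _ ≤ (1 + D) * dist x y + D * R * (K * dist x y) := by
        grw [hg.abs_stretch_sub_mul_dist_le hw hxy, hg.abs_min_one_sub_le x y, hbound]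
    _ = (1 + D * (1 + R * K) : ℝ≥0) * dist x y := by
        push_cast
        ring

theorem antilipschitzWith_radialMap (hg : IsRadialGauge g p K R) (hw : IsRadialStretch w D N) :
    AntilipschitzWith (1 + D * N * (R * K)) (radialMap g p w) := by
  refine AntilipschitzWith.of_le_mul_dist fun x y => ?_
  wlog hxy : g y ≤ g x generalizing x y with H
  · rw [dist_comm, dist_comm (radialMap g p w x)]
    exact H y x (le_of_not_ge hxy)
  set X := radialMap g p w x
  set Y := radialMap g p w y
  have hgap : |min (g x) 1 - min (g y) 1| ≤ N * (K * dist X Y) := by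
    have hmin := hw.abs_sub_le (hg.min_one_mem_Icc y) (hg.min_one_mem_Icc x)
    rw [← hg.min_map_radialMap_one hw, ← hg.min_map_radialMap_one hw] at hmin
    grw [hmin, hg.abs_min_one_sub_le]
  calc dist x y ≤ ‖w (min (g x) 1) • (x - y)‖ := by
        rw [norm_smul, dist_eq_norm]
        exact le_mul_of_one_le_left (norm_nonneg _)
          ((hw.one_le _ (hg.min_one_mem_Icc x)).trans (le_abs_self _))
    _ = ‖(X - Y) - (w (min (g x) 1) - w (min (g y) 1)) • (y - p)‖ := by
        rw [radialMap_sub_radialMap, add_sub_cancel_right]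
    _ ≤ dist X Y + |w (min (g x) 1) - w (min (g y) 1)| * dist y p := by
        rw [dist_eq_norm, dist_eq_norm, ← Real.norm_eq_abs, ← norm_smul]
        exact norm_sub_le _ _
    _ ≤ dist X Y + D * R * (N * (K * dist X Y)) := by
        grw [hg.abs_stretch_sub_mul_dist_le hw hxy, hgap]
    _ = (1 + D * N * (R * K) : ℝ≥0) * dist X Y := by
        push_cast
        ring

theorem surjective_radialMap (hg : IsRadialGauge g p K R) (hw : IsRadialStretch w D N) :
    Function.Surjective (radialMap g p w) := by
  intro x
  rcases le_total 1 (g x) with hx | hx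
  · exact ⟨x, radialMap_of_one_le hw.map_one hx⟩
  obtain ⟨t, ht, hts : t * w t = g x⟩ : g x ∈ (fun t => t * w t) '' Icc 0 1 := by
    refine intermediate_value_Icc zero_le_one (continuousOn_id.mul hw.lipschitz.continuousOn) ?_
    simpa [hw.map_one] using ⟨hg.nonneg x, hx⟩
  have hwt := zero_lt_one.trans_le (hw.one_le t ht)
  have hgt : g (p + (w t)⁻¹ • (x - p)) = t := by
    rw [hg.map_add_smul _ (inv_nonneg.2 hwt.le), add_sub_cancel, ← hts, mul_comm t,
      inv_mul_cancel_left₀ hwt.ne']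
  refine ⟨p + (w t)⁻¹ • (x - p), ?_⟩
  rw [radialMap, hgt, min_eq_left ht.2, add_sub_cancel_left, smul_inv_smul₀ hwt.ne',
    add_sub_cancel]

theorem hasFDerivAt_radialMap (hg : IsRadialGauge g p K R) {y : E} {w' : ℝ}
    (hdiff : DifferentiableAt ℝ g y) (hy : g y < 1) (hw : HasDerivAt w w' (g y)) :
    HasFDerivAt (radialMap g p w) (w (g y) • ContinuousLinearMap.id ℝ E
      + (w' • fderiv ℝ g y).smulRight (y - p)) y := by
  have hinner : HasFDerivAt (fun z => p + w (g z) • (z - p)) (w (g y) • ContinuousLinearMap.id ℝ E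
      + (w' • fderiv ℝ g y).smulRight (y - p)) y :=
    ((hw.comp_hasFDerivAt y hdiff.hasFDerivAt).smul ((hasFDerivAt_id y).sub_const p)).const_add p
  refine hinner.congr_of_eventuallyEq ?_
  filter_upwards [hg.continuous.continuousAt.eventually_mem (gt_mem_nhds hy)] with z hz
  rw [radialMap, min_eq_left (le_of_lt hz)]

variable [FiniteDimensional ℝ E] [MeasurableSpace E] [BorelSpace E] {μ : Measure E}
  [μ.IsAddHaarMeasure]

theorem transportable_radialMap (hg : IsRadialGauge g p K R) (hw : IsRadialStretch w D N)
    {ρ ρ' : E → ℝ} (hoff : ∀ y, 1 < g y → ρ y = ρ' y)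
    (hjac : ∀ᵐ y ∂μ, g y < 1 → ∃ w', HasDerivAt w w' (g y) ∧
      w (g y) ^ Module.finrank ℝ E * (1 + (w (g y))⁻¹ * (w' * g y)) * ρ' (radialMap g p w y)
        = ρ y) :
    Transportable μ {x | g x < 1} (1 + D * (1 + (1 + N) * (R * K))) ρ ρ' := by
  have hbij : Function.Bijective (radialMap g p w) :=
    ⟨(hg.antilipschitzWith_radialMap hw).injective, hg.surjective_radialMap hw⟩
  refine ⟨Equiv.ofBijective _ hbij, (hg.lipschitzWith_radialMap hw).weaken ?_,
    ((hg.antilipschitzWith_radialMap hw).to_rightInverse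
      (Equiv.ofBijective _ hbij).right_inv).weaken ?_,
    fun x hx => radialMap_of_one_le hw.map_one (not_lt.1 hx), ?_⟩
  · gcongr 1 + D * (1 + ?_)
    exact le_mul_of_one_le_left (by positivity) le_self_add
  · rw [mul_assoc]
    gcongr 1 + D * ?_
    exact le_add_left (by gcongr; exact le_add_self)
  filter_upwards [hg.lipschitz.ae_differentiableAt, hg.ae_ne μ one_pos, hjac] with y hdiff hne hjac
  rw [Equiv.coe_ofBijective]
  rcases hne.lt_or_gt with hy | hy
  · obtain ⟨w', hw', hdet⟩ := hjac hy
    have hderiv := hg.hasFDerivAt_radialMap hdiff hy hw'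
    refine ⟨hderiv.differentiableAt, ?_⟩
    have hpos := zero_lt_one.trans_le (hw.one_le _ ⟨hg.nonneg y, hy.le⟩)
    rw [hderiv.fderiv, det_smul_id_add_smulRight hpos.ne', ← hdet, smul_apply,
      hg.fderiv_apply_sub hdiff, smul_eq_mul]
  · have hid : radialMap g p w =ᶠ[𝓝 y] id := by
      filter_upwards [hg.continuous.continuousAt.eventually_mem (lt_mem_nhds hy)] with z hz
      exact radialMap_of_one_le hw.map_one (le_of_lt hz)
    refine ⟨differentiableAt_id.congr_of_eventuallyEq hid, ?_⟩
    rw [hid.fderiv_eq, fderiv_id, radialMap_of_one_le hw.map_one hy.le, hoff y hy]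
    simp [ContinuousLinearMap.det]

end IsRadialGauge

end RadialMap

/-! ### Concentrating mass at the centre of a gauge -/

section Profile

/-- The bump profile: the dilated bumps `bumpProfile (g x / l) / l ^ 2` all have the integral of
the indicator function of `{x | g x < 1}`, for every gauge `g` in dimension two. -/
noncomputable def bumpProfile (q : ℝ) : ℝ := 2 * (1 - min q 1 ^ 2)

/-- The average of `bumpProfile` over the disc of radius `q`, that is
`(∫ s in 0..q, 2 * s * bumpProfile s) / q ^ 2`: it is `2 - q ^ 2` for `q ≤ 1` and `1 / q ^ 2` for
`1 ≤ q`. -/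
noncomputable def radialProfile (q : ℝ) : ℝ := (max q 1 ^ 2)⁻¹ + 1 - min q 1 ^ 2

theorem bumpProfile_nonneg {q : ℝ} (hq : 0 ≤ q) : 0 ≤ bumpProfile q :=
  mul_nonneg zero_le_two <| sub_nonneg.2 <|
    pow_le_one₀ (le_min hq zero_le_one) (min_le_right q 1)

theorem bumpProfile_eq_zero {q : ℝ} (hq : 1 ≤ q) : bumpProfile q = 0 := by
  rw [bumpProfile, min_eq_right hq, one_pow, sub_self, mul_zero]

theorem abs_min_one_sq_sub_le {s t : ℝ} (hs : 0 ≤ s) (ht : 0 ≤ t) :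
    |min s 1 ^ 2 - min t 1 ^ 2| ≤ 2 * |s - t| := by
  have hsum : |min s 1 + min t 1| ≤ 2 := by
    rw [abs_of_nonneg (by positivity)]
    linarith [min_le_right s 1, min_le_right t 1]
  have hdiff : |min s 1 - min t 1| ≤ |s - t| := by simpa using abs_min_sub_min_le_max s 1 t 1
  rw [sq_sub_sq, abs_mul]
  gcongr

theorem lipschitzOnWith_bumpProfile : LipschitzOnWith 4 bumpProfile (Ici 0) := by
  refine LipschitzOnWith.of_dist_le_mul fun s hs t ht => ?_
  calc |bumpProfile s - bumpProfile t| = 2 * |min t 1 ^ 2 - min s 1 ^ 2| := by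
        rw [bumpProfile, bumpProfile, ← mul_sub, abs_mul, abs_two, sub_sub_sub_cancel_left]
    _ ≤ 2 * (2 * |t - s|) := by
        gcongr
        exact abs_min_one_sq_sub_le ht hs
    _ = (4 : ℝ≥0) * |s - t| := by
        rw [abs_sub_comm]
        push_cast
        ring

theorem radialProfile_of_le_one {q : ℝ} (hq : q ≤ 1) : radialProfile q = 2 - q ^ 2 := by
  rw [radialProfile, max_eq_right hq, min_eq_left hq]
  norm_num

theorem radialProfile_of_one_le {q : ℝ} (hq : 1 ≤ q) : radialProfile q = (q ^ 2)⁻¹ := by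
  rw [radialProfile, max_eq_left hq, min_eq_right hq]
  ring

theorem radialProfile_antitoneOn : AntitoneOn radialProfile (Ici 0) := by
  intro s (hs : 0 ≤ s) t _ hst
  rw [radialProfile, radialProfile]
  gcongr

theorem radialProfile_le_two (q : ℝ) : radialProfile q ≤ 2 := by
  have hmax : (max q 1 ^ 2)⁻¹ ≤ 1 := inv_le_one_of_one_le₀ (one_le_pow₀ (le_max_right q 1))
  rw [radialProfile]
  linarith [sq_nonneg (min q 1)]

theorem sq_mul_radialProfile (q : ℝ) : q ^ 2 * radialProfile q = 1 - (1 - min q 1 ^ 2) ^ 2 := by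
  rcases le_total q 1 with hq | hq
  · rw [radialProfile_of_le_one hq, min_eq_left hq]
    ring
  · rw [radialProfile_of_one_le hq, min_eq_right hq, mul_inv_cancel₀ (by positivity)]
    ring

theorem sq_mul_radialProfile_monotoneOn :
    MonotoneOn (fun q => q ^ 2 * radialProfile q) (Ici 0) := by
  intro s (hs : 0 ≤ s) t _ hst
  have ht1 : min t 1 ^ 2 ≤ 1 := pow_le_one₀ (le_min (hs.trans hst) zero_le_one) (min_le_right t 1)
  simp only [sq_mul_radialProfile]
  gcongr

theorem abs_radialProfile_sub_le {s t : ℝ} (hs : 0 ≤ s) (ht : 0 ≤ t) :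
    |radialProfile s - radialProfile t| ≤ 4 * |s - t| := by
  have hmax : |(max s 1 ^ 2)⁻¹ - (max t 1 ^ 2)⁻¹| ≤ 2 * |s - t| := by
    have hs1 : (max s 1)⁻¹ ≤ 1 := inv_le_one_of_one_le₀ (le_max_right s 1)
    have ht1 : (max t 1)⁻¹ ≤ 1 := inv_le_one_of_one_le₀ (le_max_right t 1)
    have hsum : |(max s 1)⁻¹ + (max t 1)⁻¹| ≤ 2 := by
      rw [abs_of_nonneg (by positivity)]
      linarith
    have hdiff : |(max s 1)⁻¹ - (max t 1)⁻¹| ≤ |s - t| := by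
      rw [inv_sub_inv (by positivity) (by positivity), abs_div, abs_sub_comm]
      refine (div_le_self (abs_nonneg _) ?_).trans (by simpa using abs_max_sub_max_le_max s 1 t 1)
      rw [abs_of_nonneg (by positivity)]
      exact one_le_mul_of_one_le_of_one_le (le_max_right s 1) (le_max_right t 1)
    rw [← inv_pow, ← inv_pow, sq_sub_sq, abs_mul]
    gcongr
  calc |radialProfile s - radialProfile t|
      = |((max s 1 ^ 2)⁻¹ - (max t 1 ^ 2)⁻¹) - (min s 1 ^ 2 - min t 1 ^ 2)| := by
        rw [radialProfile, radialProfile]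
        ring_nf
    _ ≤ 2 * |s - t| + 2 * |s - t| :=
        (abs_sub _ _).trans (add_le_add hmax (abs_min_one_sq_sub_le hs ht))
    _ = 4 * |s - t| := by ring

theorem exists_hasDerivAt_radialProfile {q : ℝ} (hq : 0 < q) (hq1 : q ≠ 1) :
    ∃ k, HasDerivAt radialProfile k q ∧ radialProfile q + q * k / 2 = bumpProfile q := by
  rcases hq1.lt_or_gt with hlt | hgt
  · have hderiv : HasDerivAt (fun q : ℝ => 2 - q ^ 2) (-(2 * q)) q := by
      simpa using (hasDerivAt_pow 2 q).const_sub 2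
    refine ⟨-(2 * q), hderiv.congr_of_eventuallyEq ?_, ?_⟩
    · filter_upwards [gt_mem_nhds hlt] with r hr using radialProfile_of_le_one hr.le
    · rw [radialProfile_of_le_one hlt.le, bumpProfile, min_eq_left hlt.le]
      ring
  · have hderiv : HasDerivAt (fun q : ℝ => (q ^ 2)⁻¹) (-(2 * q) / (q ^ 2) ^ 2) q := by
      simpa using (hasDerivAt_pow 2 q).fun_inv (by positivity)
    refine ⟨-(2 * q) / (q ^ 2) ^ 2, hderiv.congr_of_eventuallyEq ?_, ?_⟩
    · filter_upwards [lt_mem_nhds hgt] with r hr using radialProfile_of_one_le hr.le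
    · rw [radialProfile_of_one_le hgt.le, bumpProfile_eq_zero hgt.le]
      field_simp
      ring

end Profile

section Stretch

/-- The stretching factor of the radial map that carries the density
`1 + a * bumpProfile (g x / l) / l ^ 2` to the constant density `1 + a` on `{x | g x < 1}`, where
`g` is a gauge in dimension two. Its square is the ratio of the average densities on
`{x | g x < t}`. -/
noncomputable def stretch (l a t : ℝ) : ℝ := √((1 + a * (radialProfile (t / l) / l ^ 2)) / (1 + a))

variable {l a : ℝ≥0} {s t : ℝ}

theorem sq_le_radialProfile_div (hl : 0 < l) (hl1 : l < 1) (ht : t ∈ Icc (0 : ℝ) 1) :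
    (l : ℝ) ^ 2 ≤ radialProfile (t / l) := by
  have hl : (0 : ℝ) < l := hl
  have hone : (l : ℝ) ^ 2 = radialProfile (1 / l) := by
    rw [radialProfile_of_one_le ((one_le_div hl).2 (NNReal.coe_lt_one.2 hl1).le), one_div, inv_pow,
      inv_inv]
  rw [hone]
  exact radialProfile_antitoneOn (div_nonneg ht.1 l.coe_nonneg)
    (div_nonneg zero_le_one l.coe_nonneg) (by gcongr; exact ht.2)

theorem one_le_sq_stretch_arg (hl : 0 < l) (hl1 : l < 1) (ht : t ∈ Icc (0 : ℝ) 1) :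
    1 ≤ (1 + a * (radialProfile (t / l) / l ^ 2)) / (1 + a) := by
  have : (0 : ℝ) < l := hl
  rw [one_le_div (by positivity)]
  gcongr
  exact le_mul_of_one_le_right a.coe_nonneg
    ((one_le_div (by positivity)).2 (sq_le_radialProfile_div hl hl1 ht))

theorem sq_stretch (hl : 0 < l) (hl1 : l < 1) (ht : t ∈ Icc (0 : ℝ) 1) :
    stretch l a t ^ 2 = (1 + a * (radialProfile (t / l) / l ^ 2)) / (1 + a) :=
  Real.sq_sqrt (zero_le_one.trans (one_le_sq_stretch_arg hl hl1 ht))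

theorem one_le_stretch (hl : 0 < l) (hl1 : l < 1) (ht : t ∈ Icc (0 : ℝ) 1) :
    1 ≤ stretch l a t := Real.one_le_sqrt.2 (one_le_sq_stretch_arg hl hl1 ht)

theorem stretch_one (hl : 0 < l) (hl1 : l < 1) : stretch l a 1 = 1 := by
  have hl0 : (0 : ℝ) < l := hl
  have ha : (1 + a : ℝ) ≠ 0 := by positivity
  rw [stretch, radialProfile_of_one_le ((one_le_div hl0).2 (NNReal.coe_lt_one.2 hl1).le), one_div,
    inv_pow, inv_inv, div_self (by positivity), mul_one, div_self ha, Real.sqrt_one]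

theorem stretch_le (hl : 0 < l) (hl1 : l < 1) (ht : t ∈ Icc (0 : ℝ) 1) :
    stretch l a t ≤ 2 / l ^ 2 := by
  have hl0 : (0 : ℝ) < l := hl
  have hone := one_le_stretch (a := a) hl hl1 ht
  have hl2 : (1 : ℝ) ≤ 2 / l ^ 2 := by
    rw [one_le_div (by positivity)]
    exact (pow_le_one₀ hl0.le (NNReal.coe_lt_one.2 hl1).le).trans one_le_two
  calc stretch l a t ≤ stretch l a t ^ 2 := le_self_pow₀ hone two_ne_zero
    _ = (1 + a * (radialProfile (t / l) / l ^ 2)) / (1 + a) := sq_stretch hl hl1 ht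
    _ ≤ (2 / l ^ 2 + a * (2 / l ^ 2)) / (1 + a) := by
        gcongr
        exact radialProfile_le_two _
    _ = 2 / l ^ 2 := by field_simp

theorem lipschitzOnWith_stretch (hl : 0 < l) (hl1 : l < 1) :
    LipschitzOnWith (a / (1 + a) * (4 / l ^ 3)) (stretch l a) (Icc 0 1) := by
  have hl0 : (0 : ℝ) < l := hl
  refine LipschitzOnWith.of_dist_le_mul fun s hs t ht => ?_
  have hdiff : stretch l a s ^ 2 - stretch l a t ^ 2
      = a / (1 + a) / l ^ 2 * (radialProfile (s / l) - radialProfile (t / l)) := by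
    rw [sq_stretch hl hl1 hs, sq_stretch hl hl1 ht]
    field_simp
    ring
  have hsum : 1 ≤ |stretch l a s + stretch l a t| := by
    have hs1 := one_le_stretch (a := a) hl hl1 hs
    have ht1 := one_le_stretch (a := a) hl hl1 ht
    exact le_trans (by linarith) (le_abs_self _)
  calc |stretch l a s - stretch l a t|
      ≤ |stretch l a s + stretch l a t| * |stretch l a s - stretch l a t| :=
        le_mul_of_one_le_left (abs_nonneg _) hsum
    _ = a / (1 + a) / l ^ 2 * |radialProfile (s / l) - radialProfile (t / l)| := by
        rw [← abs_mul, ← sq_sub_sq, hdiff, abs_mul, abs_of_nonneg (by positivity)]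
    _ ≤ a / (1 + a) / l ^ 2 * (4 * |s / l - t / l|) := by
        gcongr
        exact abs_radialProfile_sub_le (div_nonneg hs.1 hl0.le) (div_nonneg ht.1 hl0.le)
    _ = (a / (1 + a) * (4 / l ^ 3) : ℝ≥0) * |s - t| := by
        rw [← sub_div, abs_div, abs_of_pos hl0]
        push_cast
        field_simp

theorem sq_sub_sq_le_stretch (hl : 0 < l) (hl1 : l < 1) (hs : 0 ≤ s) (hst : s ≤ t) (ht : t ≤ 1) :
    t ^ 2 - s ^ 2 ≤ (1 + a) * ((t * stretch l a t) ^ 2 - (s * stretch l a s) ^ 2) := by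
  have hl0 : (0 : ℝ) < l := hl
  have hsq : ∀ r ∈ Icc (0 : ℝ) 1, (1 + a) * (r * stretch l a r) ^ 2
      = r ^ 2 + a * ((r / l) ^ 2 * radialProfile (r / l)) := fun r hr => by
    rw [mul_pow, sq_stretch hl hl1 hr]
    field_simp
  have hmono := sq_mul_radialProfile_monotoneOn (div_nonneg hs hl0.le)
    (div_nonneg (hs.trans hst) hl0.le) (div_le_div_of_nonneg_right hst hl0.le)
  rw [mul_sub, hsq t ⟨hs.trans hst, ht⟩, hsq s ⟨hs, hst.trans ht⟩]
  linarith [mul_le_mul_of_nonneg_left hmono a.coe_nonneg]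

theorem sub_le_mul_stretch_sub (hl : 0 < l) (hl1 : l < 1) (hs : 0 ≤ s) (hst : s ≤ t)
    (ht : t ≤ 1) :
    t - s ≤ ((1 + a) * (2 / l ^ 2) : ℝ≥0) * (t * stretch l a t - s * stretch l a s) := by
  have : (0 : ℝ) < l := hl
  have ht0 := hs.trans hst
  rcases ht0.eq_or_lt with rfl | htpos
  · simp [le_antisymm hst hs]
  have hwt := one_le_stretch (a := a) hl hl1 ⟨ht0, ht⟩
  have hws := one_le_stretch (a := a) hl hl1 ⟨hs, hst.trans ht⟩
  have hsq := sq_sub_sq_le_stretch (a := a) hl hl1 hs hst ht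
  have hle : s * stretch l a s ≤ t * stretch l a t := by
    refine (sq_le_sq₀ (by positivity) (by positivity)).1 (sub_nonneg.1 ?_)
    have hdiff : 0 ≤ t ^ 2 - s ^ 2 := sub_nonneg.2 (by gcongr)
    exact nonneg_of_mul_nonneg_right (hdiff.trans hsq) (by positivity)
  refine le_of_mul_le_mul_right ?_ (add_pos_of_pos_of_nonneg htpos hs)
  calc (t - s) * (t + s) = t ^ 2 - s ^ 2 := by ring
    _ ≤ (1 + a) * ((t * stretch l a t) ^ 2 - (s * stretch l a s) ^ 2) := hsq
    _ = (1 + a) * (t * stretch l a t - s * stretch l a s)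
        * (t * stretch l a t + s * stretch l a s) := by ring
    _ ≤ (1 + a) * (t * stretch l a t - s * stretch l a s) *
        (t * (2 / l ^ 2) + s * (2 / l ^ 2)) := by
        have := sub_nonneg.2 hle
        gcongr
        exacts [stretch_le hl hl1 ⟨ht0, ht⟩, stretch_le hl hl1 ⟨hs, hst.trans ht⟩]
    _ = _ := by
        push_cast
        ring

theorem isRadialStretch_stretch (hl : 0 < l) (hl1 : l < 1) :
    IsRadialStretch (stretch l a) (a / (1 + a) * (4 / l ^ 3)) ((1 + a) * (2 / l ^ 2)) where
  one_le _ := one_le_stretch hl hl1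
  map_one := stretch_one hl hl1
  lipschitz := lipschitzOnWith_stretch hl hl1
  sub_le _ _ := sub_le_mul_stretch_sub hl hl1

theorem exists_hasDerivAt_stretch (hl : 0 < l) (hl1 : l < 1) (ht : 0 < t) (htl : t ≠ l)
    (ht1 : t ≤ 1) : ∃ k, HasDerivAt (stretch l a) k t ∧
      (1 + a) * (stretch l a t ^ 2 + stretch l a t * (k * t))
        = 1 + a * (bumpProfile (t / l) / l ^ 2) := by
  have hl0 : (0 : ℝ) < l := hl
  obtain ⟨k, hk, hkb⟩ := exists_hasDerivAt_radialProfile (div_pos ht hl0)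
    ((div_eq_one_iff_eq hl0.ne').not.2 htl)
  have hS : HasDerivAt (fun t : ℝ => (1 + a * (radialProfile (t / l) / l ^ 2)) / (1 + a))
      (a * (k * (1 / l) / l ^ 2) / (1 + a)) t :=
    ((((hk.comp t ((hasDerivAt_id t).div_const (l : ℝ))).div_const _).const_mul (a : ℝ)).const_add
      1).div_const _
  have hone := one_le_sq_stretch_arg (a := a) hl hl1 ⟨ht.le, ht1⟩
  refine ⟨_, hS.sqrt (zero_lt_one.trans_le hone).ne', ?_⟩
  have hpos : stretch l a t ≠ 0 := (zero_lt_one.trans_le (one_le_stretch hl hl1 ⟨ht.le, ht1⟩)).ne'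
  rw [← stretch, sq_stretch hl hl1 ⟨ht.le, ht1⟩, ← hkb]
  field_simp
  ring

end Stretch

/-- The bump of the gauge `g` supported on `{x | g x ≤ l}`; in dimension two its integral is the
area of `{x | g x < 1}`. -/
noncomputable def gaugeBump {E : Type*} (g : E → ℝ) (l : ℝ) (x : E) : ℝ :=
  bumpProfile (g x / l) / l ^ 2

theorem IsRadialGauge.exists_transportable_gaugeBump {E : Type*} [NormedAddCommGroup E]
    [NormedSpace ℝ E] [FiniteDimensional ℝ E] [MeasurableSpace E] [BorelSpace E] (μ : Measure E)
    [μ.IsAddHaarMeasure] {g : E → ℝ} {p : E} {K R l : ℝ≥0} (hE : Module.finrank ℝ E = 2)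
    (hg : IsRadialGauge g p K R) (hl : 0 < l) (hl1 : l < 1) :
    ∃ C : ℝ≥0, ∀ (a : ℝ≥0) (ρ ρ' : E → ℝ),
      (∀ x, g x < 1 → ρ x = 1 + a * gaugeBump g l x) → (∀ x, g x < 1 → ρ' x = 1 + a) →
      (∀ x, 1 < g x → ρ x = ρ' x) → Transportable μ {x | g x < 1} (1 + C * a) ρ ρ' := by
  refine ⟨4 / l ^ 3 * (1 + (1 + 2 / l ^ 2) * (R * K)), fun a ρ ρ' hρ hρ' hoff => ?_⟩
  have : Nontrivial E := Module.nontrivial_of_finrank_pos (R := ℝ) (by omega)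
  have hw := isRadialStretch_stretch (a := a) hl hl1
  refine (hg.transportable_radialMap hw hoff ?_).mono ?_ subset_rfl
  · filter_upwards [hg.ae_ne μ (NNReal.coe_pos.2 hl), Measure.ae_ne μ p] with y hyl hyp hy
    obtain ⟨k, hk, hkb⟩ := exists_hasDerivAt_stretch (a := a) hl hl1 (hg.pos hyp) hyl hy.le
    refine ⟨k, hk, ?_⟩
    have hpos := (zero_lt_one.trans_le (hw.one_le _ ⟨hg.nonneg y, hy.le⟩)).ne'
    rw [hρ y hy, hρ' _ (hg.map_radialMap_lt_one hw hy), gaugeBump, ← hkb, hE]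
    field_simp
  · have hexpand : a / (1 + a) * (4 / l ^ 3) * (1 + (1 + (1 + a) * (2 / l ^ 2)) * (R * K))
        = (a / (1 + a) * (1 + R * K) + a * (2 / l ^ 2) * (R * K)) * (4 / l ^ 3) := by
      have : 1 + a ≠ 0 := by positivity
      field_simp
      ring
    rw [hexpand]
    calc 1 + (a / (1 + a) * (1 + R * K) + a * (2 / l ^ 2) * (R * K)) * (4 / l ^ 3)
        ≤ 1 + (a * (1 + R * K) + a * (2 / l ^ 2) * (R * K)) * (4 / l ^ 3) := by
          gcongr
          exact div_le_self (by positivity) le_self_add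
      _ = _ := by ring

/-! ### Rearrangement along parallel lines -/

section Line

theorem hasCompactSupport_of_eq_zero_off_ball {E : Type*} [PseudoMetricSpace E] [ProperSpace E]
    {D : E → ℝ} {z : E} {r : ℝ}
    (h0 : ∀ x ∉ ball z r, D x = 0) : HasCompactSupport D :=
  .intro (isCompact_closedBall z r) fun x hx => h0 x fun h => hx (ball_subset_closedBall h)

variable {E : Type*} [NormedAddCommGroup E] [NormedSpace ℝ E] {e : E}

theorem isometry_add_smul (he : ‖e‖ = 1) (x : E) : Isometry fun s : ℝ => x + s • e :=
  Isometry.of_dist_eq fun s t => by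
    rw [dist_add_left, dist_eq_norm, ← sub_smul, norm_smul, he, mul_one, dist_eq_norm]

theorem integrable_comp_add_smul {D : E → ℝ} (hD : Continuous D) (hD0 : HasCompactSupport D)
    (he : ‖e‖ = 1) (x : E) : Integrable fun s : ℝ => D (x + s • e) :=
  (hD.comp (isometry_add_smul he x).continuous).integrable_of_hasCompactSupport
    (hD0.comp_isClosedEmbedding (isometry_add_smul he x).isClosedEmbedding)

theorem volume_preimage_add_smul_ball_le (he : ‖e‖ = 1) (x z : E) (r : ℝ≥0) :
    volume ((fun s : ℝ => x + s • e) ⁻¹' ball z r) ≤ 2 * r := by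
  refine (Real.volume_le_diam _).trans ?_
  rw [← (isometry_add_smul he x).ediam_image, ← eball_coe]
  exact (ediam_mono (image_preimage_subset _ _)).trans ediam_eball_le

theorem lipschitzWith_setIntegral_add_smul [ProperSpace E] {D : E → ℝ} {z : E} {r A : ℝ≥0}
    (hD : LipschitzWith A D) (h0 : ∀ x ∉ ball z r, D x = 0) (he : ‖e‖ = 1) {S : Set ℝ}
    (hS : MeasurableSet S) : LipschitzWith (4 * r * A) fun x => ∫ s in S, D (x + s • e) := by
  refine LipschitzWith.of_dist_le_mul fun x y => ?_
  have hinteg :=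
    integrable_comp_add_smul hD.continuous (hasCompactSupport_of_eq_zero_off_ball h0) he
  set T : Set ℝ := (fun s : ℝ => x + s • e) ⁻¹' ball z r ∪ (fun s : ℝ => y + s • e) ⁻¹' ball z r
  have hT : volume (S ∩ T) ≤ (4 * r : ℝ≥0) := by
    calc volume (S ∩ T) ≤ 2 * r + 2 * r :=
          (measure_mono inter_subset_right).trans <| (measure_union_le _ _).trans <|
            add_le_add (volume_preimage_add_smul_ball_le he x z r)
              (volume_preimage_add_smul_ball_le he y z r)
      _ = (4 * r : ℝ≥0) := by
          push_cast
          ring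
  have hoff : ∀ s ∈ S \ (S ∩ T), D (x + s • e) - D (y + s • e) = 0 := fun s hs => by
    have hsT : s ∉ T := fun h => hs.2 ⟨hs.1, h⟩
    rw [h0 _ fun h => hsT (.inl h), h0 _ fun h => hsT (.inr h), sub_self]
  rw [dist_eq_norm, ← integral_sub (hinteg x).integrableOn (hinteg y).integrableOn,
    setIntegral_eq_of_subset_of_forall_sdiff_eq_zero hS inter_subset_left hoff]
  calc ‖∫ s in S ∩ T, (D (x + s • e) - D (y + s • e))‖ ≤ A * dist x y * volume.real (S ∩ T) := by
        refine norm_setIntegral_le_of_norm_le_const (hT.trans_lt ENNReal.coe_lt_top) fun s _ => ?_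
        simpa only [dist_eq_norm, add_sub_add_right_eq_sub] using
          hD.dist_le_mul (x + s • e) (y + s • e)
    _ ≤ A * dist x y * (4 * r : ℝ≥0) := by
        gcongr
        exact ENNReal.toReal_le_of_le_ofReal (NNReal.coe_nonneg _) (by simpa using hT)
    _ = (4 * r * A : ℝ≥0) * dist x y := by
        push_cast
        ring

theorem abs_le_of_eq_zero_off_ball {F : E → ℝ} {z : E} {r K : ℝ≥0} (hF : LipschitzWith K F)
    (h0 : ∀ x ∉ ball z r, F x = 0) (he : ‖e‖ = 1) (x : E) : |F x| ≤ K * (2 * r) := by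
  by_cases hx : x ∈ ball z r
  · have hdist : dist x (x + (2 * r : ℝ) • e) = 2 * r := by
      rw [dist_self_add_right, norm_smul, he, mul_one, Real.norm_of_nonneg (by positivity)]
    have hfar : x + (2 * r : ℝ) • e ∉ ball z r := fun h => by
      linarith [dist_triangle_right x (x + (2 * r : ℝ) • e) z, mem_ball.1 hx, mem_ball.1 h]
    have := hF.dist_le_mul x (x + (2 * r : ℝ) • e)
    rwa [h0 _ hfar, hdist, dist_zero_right] at this
  · rw [h0 x hx, abs_zero]
    positivity

/-- The mass of the density `ρ` on the segment from `x` to `x + t • e`. -/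
noncomputable def fiberMass (e : E) (ρ : E → ℝ) (x : E) (t : ℝ) : ℝ :=
  ∫ s in (0 : ℝ)..t, ρ (x + s • e)

theorem fiberMass_zero (e : E) (ρ : E → ℝ) (x : E) : fiberMass e ρ x 0 = 0 :=
  intervalIntegral.integral_same

variable {ρ : E → ℝ}

theorem intervalIntegrable_comp_add_smul (hρ : Continuous ρ) (x : E) (a b : ℝ) :
    IntervalIntegrable (fun s : ℝ => ρ (x + s • e)) volume a b :=
  Continuous.intervalIntegrable (by fun_prop) a b

theorem fiberMass_add (hρ : Continuous ρ) (x : E) (t u : ℝ) :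
    fiberMass e ρ x (t + u) = fiberMass e ρ x t + fiberMass e ρ (x + t • e) u := by
  have hshift : fiberMass e ρ (x + t • e) u = ∫ s in t..t + u, ρ (x + s • e) := by
    simp only [fiberMass, add_assoc, ← add_smul]
    rw [intervalIntegral.integral_comp_add_left (fun s => ρ (x + s • e)), add_zero]
  rw [hshift, fiberMass, fiberMass, intervalIntegral.integral_add_adjacent_intervals] <;>
    exact intervalIntegrable_comp_add_smul hρ x _ _

theorem hasDerivAt_fiberMass (e : E) (hρ : Continuous ρ) (x : E) (t : ℝ) :
    HasDerivAt (fiberMass e ρ x) (ρ (x + t • e)) t := by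
  have hc : Continuous fun s : ℝ => ρ (x + s • e) := by fun_prop
  exact intervalIntegral.integral_hasDerivAt_right (hc.intervalIntegrable _ _)
    (hc.stronglyMeasurableAtFilter _ _) hc.continuousAt

theorem sub_le_fiberMass_sub (e : E) (hρ : Continuous ρ) (hρ1 : ∀ x, 1 ≤ ρ x) (x : E) {t u : ℝ}
    (htu : t ≤ u) : u - t ≤ fiberMass e ρ x u - fiberMass e ρ x t := by
  rw [fiberMass, fiberMass, intervalIntegral.integral_interval_sub_left
    (intervalIntegrable_comp_add_smul hρ x _ _) (intervalIntegrable_comp_add_smul hρ x _ _)]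
  simpa using intervalIntegral.integral_mono_on htu (intervalIntegrable_const (c := (1 : ℝ)))
    (intervalIntegrable_comp_add_smul hρ x t u) fun s _ => hρ1 (x + s • e)

theorem abs_sub_le_abs_fiberMass_sub (e : E) (hρ : Continuous ρ) (hρ1 : ∀ x, 1 ≤ ρ x) (x : E)
    (t u : ℝ) : |t - u| ≤ |fiberMass e ρ x t - fiberMass e ρ x u| := by
  wlog hut : u ≤ t generalizing t u with H
  · rw [abs_sub_comm, abs_sub_comm (fiberMass e ρ x t)]
    exact H u t (le_of_not_ge hut)
  rw [abs_of_nonneg (sub_nonneg.2 hut)]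
  exact (sub_le_fiberMass_sub e hρ hρ1 x hut).trans (le_abs_self _)

theorem surjective_fiberMass (e : E) (hρ : Continuous ρ) (hρ1 : ∀ x, 1 ≤ ρ x) (x : E) :
    Function.Surjective (fiberMass e ρ x) := by
  have hcont : Continuous (fiberMass e ρ x) :=
    continuous_iff_continuousAt.2 fun t => (hasDerivAt_fiberMass e hρ x t).continuousAt
  refine hcont.surjective (tendsto_atTop_mono' _ ?_ tendsto_id)
    (tendsto_atBot_mono' _ ?_ tendsto_id)
  · filter_upwards [eventually_ge_atTop 0] with t ht
    simpa [fiberMass_zero] using sub_le_fiberMass_sub e hρ hρ1 x ht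
  · filter_upwards [eventually_le_atBot 0] with t ht
    simpa [fiberMass_zero] using sub_le_fiberMass_sub e hρ hρ1 x ht

theorem abs_fiberMass_sub_le {A : ℝ≥0} (hρ : LipschitzWith A ρ) (x y : E) (t : ℝ) :
    |fiberMass e ρ x t - fiberMass e ρ y t| ≤ A * dist x y * |t| := by
  have hbound := intervalIntegral.norm_integral_le_of_norm_le_const (a := 0) (b := t)
    (f := fun s : ℝ => ρ (x + s • e) - ρ (y + s • e)) (C := A * dist x y) fun s _ => by
      simpa only [dist_eq_norm, add_sub_add_right_eq_sub] using
        hρ.dist_le_mul (x + s • e) (y + s • e)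
  rwa [sub_zero, intervalIntegral.integral_sub
    (intervalIntegrable_comp_add_smul hρ.continuous x 0 t)
    (intervalIntegrable_comp_add_smul hρ.continuous y 0 t)] at hbound

/-- Two Lipschitz densities that agree off a bounded convex set and have the same integral along
every line of direction `e`. -/
structure IsFiberPair (e : E) (ρ ρ' : E → ℝ) (Q : Set E) (z : E) (r A : ℝ≥0) : Prop where
  norm_eq : ‖e‖ = 1
  one_le : ∀ x, 1 ≤ ρ x
  one_le' : ∀ x, 1 ≤ ρ' x
  lipschitz : LipschitzWith A ρ
  lipschitz' : LipschitzWith A ρ'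
  convex : Convex ℝ Q
  subset_ball : Q ⊆ ball z r
  eq_off : ∀ x ∉ Q, ρ x = ρ' x
  integral_eq : ∀ x, ∫ s : ℝ, (ρ (x + s • e) - ρ' (x + s • e)) = 0

/-- The excess of `ρ` over `ρ'` on the half-line that ends at `x` in direction `e`. -/
noncomputable def fiberExcess (e : E) (ρ ρ' : E → ℝ) (x : E) : ℝ :=
  ∫ s in Iic (0 : ℝ), (ρ (x + s • e) - ρ' (x + s • e))

theorem fiberExcess_swap (e : E) (ρ ρ' : E → ℝ) (x : E) :
    fiberExcess e ρ' ρ x = -fiberExcess e ρ ρ' x := by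
  simp only [fiberExcess, ← integral_neg, neg_sub]

namespace IsFiberPair

variable {z : E} {ρ' : E → ℝ} {Q : Set E} {r A : ℝ≥0}

theorem symm (h : IsFiberPair e ρ ρ' Q z r A) : IsFiberPair e ρ' ρ Q z r A where
  norm_eq := h.norm_eq
  one_le := h.one_le'
  one_le' := h.one_le
  lipschitz := h.lipschitz'
  lipschitz' := h.lipschitz
  convex := h.convex
  subset_ball := h.subset_ball
  eq_off x hx := (h.eq_off x hx).symm
  integral_eq x := by
    rw [← neg_eq_zero, ← integral_neg]
    simpa only [neg_sub] using h.integral_eq x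

theorem sub_eq_zero_off_ball (h : IsFiberPair e ρ ρ' Q z r A) {x : E} (hx : x ∉ ball z r) :
    ρ x - ρ' x = 0 :=
  sub_eq_zero.2 (h.eq_off x fun hxQ => hx (h.subset_ball hxQ))

theorem fiberExcess_eq_zero (h : IsFiberPair e ρ ρ' Q z r A) {x : E} (hx : x ∉ Q) :
    fiberExcess e ρ ρ' x = 0 := by
  have hord : OrdConnected ((fun s : ℝ => x + s • e) ⁻¹' Q) := by
    have hline : (fun s : ℝ => x + s • e) = AffineMap.lineMap x (x + e) := by
      ext s
      simp [AffineMap.lineMap_apply, add_comm]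
    rw [hline]
    exact (h.convex.affine_preimage _).ordConnected
  have hside : (∀ s : ℝ, s ≤ 0 → x + s • e ∉ Q) ∨ ∀ t : ℝ, 0 ≤ t → x + t • e ∉ Q := by
    by_contra! ⟨⟨s, hs, hsQ⟩, t, ht, htQ⟩
    exact hx (by simpa using hord.out hsQ htQ ⟨hs, ht⟩)
  rcases hside with hneg | hpos
  · exact setIntegral_eq_zero_of_forall_eq_zero fun s hs => sub_eq_zero.2 (h.eq_off _ (hneg s hs))
  · rw [← h.integral_eq x, fiberExcess]
    exact setIntegral_eq_integral_of_forall_compl_eq_zero fun t ht =>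
      sub_eq_zero.2 (h.eq_off _ (hpos t (not_le.1 ht).le))

/-- The displacements `d` that make `x ↦ x + d x • e` carry the mass of `ρ` on the half-line ending
at `x` to the mass of `ρ'` on the half-line ending at `x + d x • e`. -/
def IsShift (e : E) (ρ ρ' d : E → ℝ) : Prop :=
  ∀ x, fiberMass e ρ' x (d x) = fiberExcess e ρ ρ' x

variable {d d' : E → ℝ}

theorem exists_isShift (h : IsFiberPair e ρ ρ' Q z r A) : ∃ d, IsShift e ρ ρ' d := by
  choose d hd using surjective_fiberMass e h.lipschitz'.continuous h.one_le'
  exact ⟨fun x => d x (fiberExcess e ρ ρ' x), fun x => hd x _⟩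

theorem abs_shift_le (h : IsFiberPair e ρ ρ' Q z r A) (hd : IsShift e ρ ρ' d) (x : E) :
    |d x| ≤ |fiberExcess e ρ ρ' x| := by
  simpa [fiberMass_zero, hd x] using
    abs_sub_le_abs_fiberMass_sub e h.lipschitz'.continuous h.one_le' x (d x) 0

theorem shift_eq_zero (h : IsFiberPair e ρ ρ' Q z r A) (hd : IsShift e ρ ρ' d) {x : E}
    (hx : x ∉ Q) : d x = 0 := by
  simpa [h.fiberExcess_eq_zero hx] using h.abs_shift_le hd x

variable [FiniteDimensional ℝ E]

theorem integrable (h : IsFiberPair e ρ ρ' Q z r A) (x : E) :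
    Integrable fun s : ℝ => ρ (x + s • e) - ρ' (x + s • e) :=
  have := FiniteDimensional.proper ℝ E
  integrable_comp_add_smul (D := ρ - ρ') (h.lipschitz.continuous.sub h.lipschitz'.continuous)
    (hasCompactSupport_of_eq_zero_off_ball fun _ => h.sub_eq_zero_off_ball) h.norm_eq x

theorem lipschitzWith_fiberExcess (h : IsFiberPair e ρ ρ' Q z r A) :
    LipschitzWith (8 * r * A) (fiberExcess e ρ ρ') := by
  have := FiniteDimensional.proper ℝ E
  exact (lipschitzWith_setIntegral_add_smul (D := ρ - ρ') (h.lipschitz.sub h.lipschitz')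
    (fun _ => h.sub_eq_zero_off_ball) h.norm_eq measurableSet_Iic).weaken (by ring_nf; rfl)

theorem fiberExcess_add_smul (h : IsFiberPair e ρ ρ' Q z r A) (x : E) (t : ℝ) :
    fiberExcess e ρ ρ' (x + t • e)
      = fiberExcess e ρ ρ' x + (fiberMass e ρ x t - fiberMass e ρ' x t) := by
  have hshift : fiberExcess e ρ ρ' (x + t • e)
      = ∫ s in Iic t, (ρ (x + s • e) - ρ' (x + s • e)) := by
    have hpre : (fun s => t + s) ⁻¹' Iic t = Iic (0 : ℝ) := by simp
    simp only [fiberExcess, add_assoc, ← add_smul]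
    rw [← (measurePreserving_add_left volume t).setIntegral_preimage_emb
      (MeasurableEquiv.addLeft t).measurableEmbedding
      (fun s => ρ (x + s • e) - ρ' (x + s • e)), hpre]
  rw [hshift, fiberExcess, fiberMass, fiberMass, ← intervalIntegral.integral_sub
    (intervalIntegrable_comp_add_smul h.lipschitz.continuous x 0 t)
    (intervalIntegrable_comp_add_smul h.lipschitz'.continuous x 0 t),
    ← intervalIntegral.integral_Iic_sub_Iic (h.integrable x).integrableOn
      (h.integrable x).integrableOn, add_sub_cancel]

theorem lipschitzWith_shift (h : IsFiberPair e ρ ρ' Q z r A) (hd : IsShift e ρ ρ' d) :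
    LipschitzWith (8 * r * A + 16 * r ^ 2 * A ^ 2) d := by
  refine LipschitzWith.of_dist_le_mul fun x y => ?_
  have hdx : |d x| ≤ (8 * r * A : ℝ≥0) * (2 * r) :=
    (h.abs_shift_le hd x).trans <| abs_le_of_eq_zero_off_ball h.lipschitzWith_fiberExcess
      (fun x hx => h.fiberExcess_eq_zero fun hxQ => hx (h.subset_ball hxQ)) h.norm_eq x
  calc |d x - d y| ≤ |fiberMass e ρ' y (d x) - fiberMass e ρ' y (d y)| :=
        abs_sub_le_abs_fiberMass_sub e h.lipschitz'.continuous h.one_le' y _ _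
    _ = |(fiberExcess e ρ ρ' x - fiberExcess e ρ ρ' y)
          - (fiberMass e ρ' x (d x) - fiberMass e ρ' y (d x))| := by
        rw [hd y, hd x]
        ring_nf
    _ ≤ (8 * r * A : ℝ≥0) * dist x y + A * dist x y * ((8 * r * A : ℝ≥0) * (2 * r)) := by
        refine (abs_sub _ _).trans (add_le_add (h.lipschitzWith_fiberExcess.dist_le_mul x y) ?_)
        exact (abs_fiberMass_sub_le h.lipschitz' x y _).trans (by gcongr)
    _ = (8 * r * A + 16 * r ^ 2 * A ^ 2 : ℝ≥0) * dist x y := by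
        push_cast
        ring

theorem fiberMass_shift (h : IsFiberPair e ρ ρ' Q z r A) (hd : IsShift e ρ ρ' d) (x : E) (t : ℝ) :
    fiberMass e ρ' x (t + d (x + t • e)) = fiberExcess e ρ ρ' x + fiberMass e ρ x t := by
  rw [fiberMass_add h.lipschitz'.continuous, hd, h.fiberExcess_add_smul]
  ring

theorem shift_shift (h : IsFiberPair e ρ ρ' Q z r A) (hd : IsShift e ρ ρ' d)
    (hd' : IsShift e ρ' ρ d') (x : E) : d' (x + d x • e) = -d x := by
  have hmass := h.symm.fiberMass_shift hd' x (d x)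
  rw [hd x, fiberExcess_swap, neg_add_cancel] at hmass
  have hinj := abs_sub_le_abs_fiberMass_sub e h.lipschitz.continuous h.one_le x
    (d x + d' (x + d x • e)) 0
  rw [hmass, fiberMass_zero, sub_zero, sub_self, abs_zero, abs_nonpos_iff] at hinj
  exact (neg_eq_of_add_eq_zero_right hinj).symm

theorem one_add_fderiv_shift_mul (h : IsFiberPair e ρ ρ' Q z r A) (hd : IsShift e ρ ρ' d) {x : E}
    (hx : DifferentiableAt ℝ d x) : (1 + fderiv ℝ d x e) * ρ' (x + d x • e) = ρ x := by
  have hx' : HasFDerivAt d (fderiv ℝ d x) (x + (0 : ℝ) • e) := by simpa using hx.hasFDerivAt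
  have hline : HasDerivAt (fun t : ℝ => x + t • e) e 0 := by
    simpa using ((hasDerivAt_id (0 : ℝ)).smul_const e).const_add x
  have hleft := (hasDerivAt_fiberMass e h.lipschitz'.continuous x _).comp (0 : ℝ)
    ((hasDerivAt_id (0 : ℝ)).add (hx'.comp_hasDerivAt (0 : ℝ) hline))
  have hright := (hasDerivAt_fiberMass e h.lipschitz.continuous x 0).const_add
    (fiberExcess e ρ ρ' x)
  have := (hleft.congr_of_eventuallyEq
    (.of_forall fun t => (h.fiberMass_shift hd x t).symm)).unique hright
  simpa [mul_comm] using this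

theorem lipschitzWith_add_shift (h : IsFiberPair e ρ ρ' Q z r A) (hd : IsShift e ρ ρ' d) :
    LipschitzWith ((1 + 4 * r * A) ^ 2) fun x => x + d x • e := by
  have hsmul : LipschitzWith (8 * r * A + 16 * r ^ 2 * A ^ 2) fun x => d x • e :=
    LipschitzWith.of_dist_le_mul fun x y => by
      rw [dist_eq_norm, ← sub_smul, norm_smul, h.norm_eq, mul_one, ← dist_eq_norm]
      exact (h.lipschitzWith_shift hd).dist_le_mul x y
  exact (LipschitzWith.id.add hsmul).weaken (by ring_nf; rfl)

variable [MeasurableSpace E] [BorelSpace E]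

theorem transportable (μ : Measure E) [μ.IsAddHaarMeasure] (h : IsFiberPair e ρ ρ' Q z r A) :
    Transportable μ Q ((1 + 4 * r * A) ^ 2) ρ ρ' := by
  obtain ⟨d, hd⟩ := h.exists_isShift
  obtain ⟨d', hd'⟩ := h.symm.exists_isShift
  refine ⟨⟨fun x => x + d x • e, fun x => x + d' x • e, fun x => ?_, fun x => ?_⟩,
    h.lipschitzWith_add_shift hd, h.symm.lipschitzWith_add_shift hd', fun x hx => ?_, ?_⟩
  · simp [h.shift_shift hd hd' x]
  · simp [h.symm.shift_shift hd' hd x]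
  · simp [h.shift_eq_zero hd hx]
  filter_upwards [(h.lipschitzWith_shift hd).ae_differentiableAt] with x hx
  have hderiv : HasFDerivAt (fun x => x + d x • e)
      ((1 : ℝ) • ContinuousLinearMap.id ℝ E + (fderiv ℝ d x).smulRight e) x := by
    rw [one_smul]
    exact (hasFDerivAt_id x).add (hx.hasFDerivAt.smul_const e)
  refine ⟨hderiv.differentiableAt, ?_⟩
  rw [Equiv.coe_fn_mk, hderiv.fderiv, det_smul_id_add_smulRight one_ne_zero, one_pow, one_mul,
    inv_one, one_mul]
  exact h.one_add_fderiv_shift_mul hd hx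

end IsFiberPair

end Line

/-! ### Exchanging bumps -/

/-- A nonnegative Lipschitz function that vanishes off `S`. -/
structure IsBump {X : Type*} [PseudoMetricSpace X] (b : X → ℝ) (S : Set X) : Prop where
  nonneg : ∀ x, 0 ≤ b x
  exists_lipschitzWith : ∃ K, LipschitzWith K b
  eq_off : ∀ x ∉ S, b x = 0

namespace IsBump

variable {X : Type*} [PseudoMetricSpace X] {b : X → ℝ} {S S' : Set X}

theorem continuous (hb : IsBump b S) : Continuous b :=
  hb.exists_lipschitzWith.choose_spec.continuous

theorem mono (hb : IsBump b S) (h : S ⊆ S') : IsBump b S' where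
  nonneg := hb.nonneg
  exists_lipschitzWith := hb.exists_lipschitzWith
  eq_off x hx := hb.eq_off x fun hx' => hx (h hx')

theorem const_mul (hb : IsBump b S) (a : ℝ≥0) : IsBump (fun x => a * b x) S where
  nonneg x := mul_nonneg a.coe_nonneg (hb.nonneg x)
  exists_lipschitzWith :=
    hb.exists_lipschitzWith.imp' _ fun _ hK => (lipschitzWith_smul (a : ℝ)).comp hK
  eq_off x hx := by rw [hb.eq_off x hx, mul_zero]

variable [ProperSpace X]

theorem hasCompactSupport (hb : IsBump b S) (hS : Bornology.IsBounded S) : HasCompactSupport b :=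
  .intro' hS.isCompact_closure isClosed_closure fun x hx =>
    hb.eq_off x fun hx' => hx (subset_closure hx')

theorem exists_le (hb : IsBump b S) (hS : Bornology.IsBounded S) : ∃ B : ℝ≥0, ∀ x, b x ≤ B := by
  obtain ⟨B, hB⟩ := hb.continuous.bounded_above_of_compact_support (hb.hasCompactSupport hS)
  exact ⟨B.toNNReal, fun x => (le_abs_self _).trans ((hB x).trans (Real.le_coe_toNNReal B))⟩

theorem integral_pos {b : ℝ → ℝ} {S : Set ℝ} (hb : IsBump b S) (hS : Bornology.IsBounded S) {s : ℝ}
    (hs : b s ≠ 0) : 0 < ∫ t, b t :=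
  hb.continuous.integral_pos_of_hasCompactSupport_nonneg_nonzero (hb.hasCompactSupport hS)
    hb.nonneg hs

end IsBump

/-- The small backgrounds over which bumps are moved: nonnegative functions with a Lipschitz
constant proportional to `ε`. -/
structure IsBackground {X : Type*} [PseudoMetricSpace X] (A ε : ℝ≥0) (h : X → ℝ) : Prop where
  nonneg : ∀ x, 0 ≤ h x
  lipschitzWith : LipschitzWith (A * ε) h

theorem IsBackground.lipschitzWith_one_add_add {X : Type*} [PseudoMetricSpace X]
    {A ε a K L : ℝ≥0} {h b : X → ℝ}
    (hh : IsBackground A ε h) (ha : a ≤ ε) (hb : LipschitzWith K b) (hKL : K ≤ L) :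
    LipschitzWith ((A + L) * ε) fun x => 1 + h x + a * b x := by
  have hsum := ((LipschitzWith.const (1 : ℝ)).add hh.lipschitzWith).add
    ((lipschitzWith_smul (a : ℝ)).comp hb)
  refine hsum.weaken ?_
  rw [Real.nnnorm_of_nonneg a.coe_nonneg, zero_add, add_mul, mul_comm L]
  gcongr
  exact ha

section Exchange

variable {E : Type*} [NormedAddCommGroup E] [NormedSpace ℝ E] [MeasurableSpace E] {μ : Measure E}
  {H H' : ℝ≥0 → (E → ℝ) → Prop} {U V : Set E} {k k₁ k₂ : ℝ} {b c d : E → ℝ}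

/-- Over every background `h` with `H ε h`, the excess `a • b` can be replaced by `a • c`, for all
`a ≤ ε` and at the price of a biLipschitz constant `(1 + ε) ^ k`. -/
def Exchangeable (μ : Measure E) (H : ℝ≥0 → (E → ℝ) → Prop) (U : Set E) (k : ℝ) (b c : E → ℝ) :
    Prop :=
  ∀ ε a : ℝ≥0, a ≤ ε → ∀ h, H ε h →
    Transportable μ U ((1 + ε) ^ k) (fun x => 1 + h x + a * b x) (fun x => 1 + h x + a * c x)

namespace Exchangeable

theorem mono (h : Exchangeable μ H U k b c) (hH : ∀ ε f, H' ε f → H ε f) (hU : U ⊆ V) :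
    Exchangeable μ H' V k b c :=
  fun ε a ha f hf => (h ε a ha f (hH ε f hf)).mono le_rfl hU

theorem trans [FiniteDimensional ℝ E] [BorelSpace E] [μ.IsAddHaarMeasure]
    (h₁ : Exchangeable μ H U k₁ b c) (h₂ : Exchangeable μ H U k₂ c d) :
    Exchangeable μ H U (k₁ + k₂) b d :=
  fun ε a ha f hf => (h₁ ε a ha f hf).trans_rpow (h₂ ε a ha f hf)

end Exchangeable

variable [FiniteDimensional ℝ E] [BorelSpace E]

theorem exists_exchangeable_of_integral_eq (μ : Measure E) [μ.IsAddHaarMeasure] {Q : Set E} {e : E}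
    (he : ‖e‖ = 1) (hQ : Convex ℝ Q) (hQb : Bornology.IsBounded Q) (hb : IsBump b Q)
    (hc : IsBump c Q) (hbc : ∀ x, ∫ s : ℝ, b (x + s • e) = ∫ s : ℝ, c (x + s • e)) (A : ℝ≥0) :
    ∃ k, Exchangeable μ (IsBackground A) Q k b c := by
  have := FiniteDimensional.proper ℝ E
  obtain ⟨Kb, hKb⟩ := hb.exists_lipschitzWith
  obtain ⟨Kc, hKc⟩ := hc.exists_lipschitzWith
  obtain ⟨r, -, hr⟩ := hQb.subset_ball_lt 0 0
  set M := A + max Kb Kc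
  have hinteg {f : E → ℝ} (hf : IsBump f Q) (x : E) : Integrable fun s : ℝ => f (x + s • e) :=
    integrable_comp_add_smul hf.continuous (hf.hasCompactSupport hQb) he x
  refine ⟨max (4 * r.toNNReal * M : ℝ≥0) 1 * 2, fun ε a ha h hh => ?_⟩
  have hpair : IsFiberPair e (fun x => 1 + h x + a * b x) (fun x => 1 + h x + a * c x) Q 0
      r.toNNReal (M * ε) := {
    norm_eq := he
    one_le x := by linarith [hh.nonneg x, (hb.const_mul a).nonneg x]
    one_le' x := by linarith [hh.nonneg x, (hc.const_mul a).nonneg x]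
    lipschitz := hh.lipschitzWith_one_add_add ha hKb (le_max_left _ _)
    lipschitz' := hh.lipschitzWith_one_add_add ha hKc (le_max_right _ _)
    convex := hQ
    subset_ball := hr.trans (ball_subset_ball (Real.le_coe_toNNReal r))
    eq_off x hx := by rw [hb.eq_off x hx, hc.eq_off x hx]
    integral_eq x := by
      simp only [add_sub_add_left_eq_sub]
      rw [integral_sub ((hinteg hb x).const_mul _) ((hinteg hc x).const_mul _), integral_const_mul,
        integral_const_mul, hbc, sub_self] }
  refine (hpair.transportable μ).mono ?_ subset_rfl
  rw [NNReal.rpow_mul, NNReal.rpow_two, ← mul_assoc]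
  gcongr
  exact one_add_mul_le_rpow _ ε

end Exchange

theorem lipschitzWith_mul_of_abs_le {X : Type*} [PseudoMetricSpace X] {f g : X → ℝ}
    {K L B C : ℝ≥0} (hf : LipschitzWith K f) (hg : LipschitzWith L g) (hB : ∀ x, |f x| ≤ B)
    (hC : ∀ x, |g x| ≤ C) : LipschitzWith (B * L + C * K) fun x => f x * g x :=
  LipschitzWith.of_dist_le_mul fun x y => by
    calc |f x * g x - f y * g y| = |f x * (g x - g y) + g y * (f x - f y)| := by ring_nf
      _ ≤ |f x| * |g x - g y| + |g y| * |f x - f y| := by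
        simpa only [abs_mul] using abs_add_le (f x * (g x - g y)) (g y * (f x - f y))
      _ ≤ B * (L * dist x y) + C * (K * dist x y) := by
        gcongr
        exacts [hB x, hg.dist_le_mul x y, hC y, hf.dist_le_mul x y]
      _ = (B * L + C * K : ℝ≥0) * dist x y := by
        push_cast
        ring

section ProductBump

variable {E : Type*} [NormedAddCommGroup E] [InnerProductSpace ℝ E]

theorem exists_orthonormalBasis_inner_eq_zero (hE : Module.finrank ℝ E = 2) (v : E) :
    ∃ u : OrthonormalBasis (Fin 2) ℝ E, inner ℝ (u 1) v = 0 := by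
  have := Module.finite_of_finrank_eq_succ hE
  rcases eq_or_ne v 0 with rfl | hv
  · exact ⟨(stdOrthonormalBasis ℝ E).reindex (finCongr hE), inner_zero_right _⟩
  have hunit : Orthonormal ℝ (({0} : Set (Fin 2)).domRestrict fun _ => ‖v‖⁻¹ • v) :=
    ⟨fun _ => norm_smul_inv_norm hv, fun i j hij => (hij (Subsingleton.elim i j)).elim⟩
  obtain ⟨u, hu⟩ := hunit.exists_orthonormalBasis_extension_of_card_eq (by simpa using hE)
  refine ⟨u, ?_⟩
  have h10 : inner ℝ (u 1) (u 0) = 0 := u.orthonormal.2 (by decide)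
  rw [hu 0 rfl, inner_smul_right] at h10
  exact (mul_eq_zero.1 h10).resolve_left (inv_ne_zero (norm_ne_zero_iff.2 hv))

variable {u : OrthonormalBasis (Fin 2) ℝ E} {f g : ℝ → ℝ} {b : E → ℝ} {z : E} {η : ℝ}

/-- The function `f ⊗ g` in the Cartesian coordinates about `z` along the orthonormal basis `u`. -/
noncomputable def productBump (u : OrthonormalBasis (Fin 2) ℝ E) (z : E) (f g : ℝ → ℝ) (x : E) :
    ℝ :=
  f (inner ℝ (u 0) (x - z)) * g (inner ℝ (u 1) (x - z))

/-- The integrals of `b` along the lines of direction `u 1`, parametrised by the coordinate along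
`u 0` about `z`. -/
noncomputable def crossProfile (u : OrthonormalBasis (Fin 2) ℝ E) (z : E) (b : E → ℝ) (s : ℝ) :
    ℝ :=
  ∫ v : ℝ, b (z + s • u 0 + v • u 1)

theorem abs_inner_sub_le_dist {e : E} (he : ‖e‖ = 1) (x z : E) :
    |inner ℝ e (x - z)| ≤ dist x z := by
  simpa [he, dist_eq_norm] using abs_real_inner_le_norm e (x - z)

theorem lipschitzWith_inner_sub {e : E} (he : ‖e‖ = 1) (z : E) :
    LipschitzWith 1 fun x : E => inner ℝ e (x - z) :=
  LipschitzWith.of_dist_le_mul fun x y => by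
    rw [Real.dist_eq, ← inner_sub_right, sub_sub_sub_cancel_right, NNReal.coe_one, one_mul]
    exact abs_inner_sub_le_dist he x y

theorem exists_isBump_integral_eq_one (hη : 0 < η) :
    ∃ χ : ℝ → ℝ, IsBump χ (closedBall 0 η) ∧ ∫ s, χ s = 1 := by
  let χ : ContDiffBump (0 : ℝ) := ⟨η / 2, η, half_pos hη, half_lt_self hη⟩
  refine ⟨χ.normed volume, ⟨χ.nonneg_normed, ?_, fun x hx => ?_⟩, χ.integral_normed⟩
  · exact (χ.contDiff_normed (n := 1)).lipschitzWith_of_hasCompactSupport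
      χ.hasCompactSupport_normed one_ne_zero
  · exact Function.notMem_support.1 fun h =>
      hx (ball_subset_closedBall (χ.support_normed_eq (μ := volume) ▸ h))

theorem eq_add_smul_add_smul (u : OrthonormalBasis (Fin 2) ℝ E) (z x : E) :
    x = z + inner ℝ (u 0) (x - z) • u 0 + inner ℝ (u 1) (x - z) • u 1 := by
  have hsum := u.sum_repr' (x - z)
  rw [Fin.sum_univ_two] at hsum
  rw [add_assoc, hsum, add_sub_cancel]

theorem isBump_productBump (hf : IsBump f (closedBall 0 η)) (hg : IsBump g (closedBall 0 η)) :
    IsBump (productBump u z f g) (closedBall z (2 * η)) := by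
  obtain ⟨K, hK⟩ := hf.exists_lipschitzWith
  obtain ⟨L, hL⟩ := hg.exists_lipschitzWith
  obtain ⟨B, hB⟩ := hf.exists_le isBounded_closedBall
  obtain ⟨C, hC⟩ := hg.exists_le isBounded_closedBall
  have hcoord (i : Fin 2) := lipschitzWith_inner_sub (u.norm_eq_one i) z
  refine ⟨fun x => mul_nonneg (hf.nonneg _) (hg.nonneg _),
    ⟨_, lipschitzWith_mul_of_abs_le (hK.comp (hcoord 0)) (hL.comp (hcoord 1))
      (fun x => (abs_of_nonneg (hf.nonneg _)).trans_le (hB _))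
      (fun x => (abs_of_nonneg (hg.nonneg _)).trans_le (hC _))⟩,
    fun x hx => ?_⟩
  by_contra hne
  obtain ⟨hf0, hg0⟩ := mul_ne_zero_iff.1 hne
  have h0 : |inner ℝ (u 0) (x - z)| ≤ η := by simpa using not_imp_comm.1 (hf.eq_off _) hf0
  have h1 : |inner ℝ (u 1) (x - z)| ≤ η := by simpa using not_imp_comm.1 (hg.eq_off _) hg0
  refine hx (mem_closedBall.2 ?_)
  calc dist x z = ‖inner ℝ (u 0) (x - z) • u 0 + inner ℝ (u 1) (x - z) • u 1‖ := by
        conv_lhs => rw [eq_add_smul_add_smul u z x, add_assoc, dist_self_add_left]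
    _ ≤ |inner ℝ (u 0) (x - z)| + |inner ℝ (u 1) (x - z)| := by
        simpa [norm_smul] using norm_add_le (inner ℝ (u 0) (x - z) • u 0)
          (inner ℝ (u 1) (x - z) • u 1)
    _ ≤ 2 * η := by linarith

theorem integral_productBump_add_smul_zero (u : OrthonormalBasis (Fin 2) ℝ E) (z : E) (f g : ℝ → ℝ)
    (x : E) : ∫ s : ℝ, productBump u z f g (x + s • u 0)
      = (∫ s, f s) * g (inner ℝ (u 1) (x - z)) := by
  have h10 : inner ℝ (u 1) (u 0) = 0 := u.orthonormal.2 (by decide)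
  simp only [productBump, add_sub_right_comm x _ z, inner_add_right, inner_smul_right, h10,
    real_inner_self_eq_norm_sq, u.norm_eq_one, one_pow, mul_one, mul_zero, add_zero]
  rw [integral_mul_const, integral_add_left_eq_self]

theorem integral_productBump_add_smul_one (u : OrthonormalBasis (Fin 2) ℝ E) (z : E) (f g : ℝ → ℝ)
    (x : E) : ∫ s : ℝ, productBump u z f g (x + s • u 1)
      = f (inner ℝ (u 0) (x - z)) * ∫ s, g s := by
  have h01 : inner ℝ (u 0) (u 1) = 0 := u.orthonormal.2 (by decide)
  simp only [productBump, add_sub_right_comm x _ z, inner_add_right, inner_smul_right, h01,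
    real_inner_self_eq_norm_sq, u.norm_eq_one, one_pow, mul_one, mul_zero, add_zero]
  rw [integral_const_mul, integral_add_left_eq_self]

theorem integral_add_smul_one (u : OrthonormalBasis (Fin 2) ℝ E) (z : E) (b : E → ℝ) (x : E) :
    ∫ s : ℝ, b (x + s • u 1) = crossProfile u z b (inner ℝ (u 0) (x - z)) := by
  rw [crossProfile, ← integral_add_left_eq_self
    (fun v => b (z + inner ℝ (u 0) (x - z) • u 0 + v • u 1)) (inner ℝ (u 1) (x - z))]
  refine integral_congr_ae (.of_forall fun s => congrArg b ?_)
  rw [add_smul, ← add_assoc, ← eq_add_smul_add_smul u z x]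

theorem isBump_crossProfile (u : OrthonormalBasis (Fin 2) ℝ E) (hb : IsBump b (closedBall z η)) :
    IsBump (crossProfile u z b) (closedBall 0 η) where
  nonneg s := integral_nonneg fun v => hb.nonneg _
  exists_lipschitzWith := by
    have := u.toBasis.finiteDimensional_of_finite
    have := FiniteDimensional.proper ℝ E
    obtain ⟨K, hK⟩ := hb.exists_lipschitzWith
    have hoff : ∀ x ∉ ball z (η + 1).toNNReal, b x = 0 := fun x hx => hb.eq_off x fun hxη =>
      hx <| mem_ball.2 <| (mem_closedBall.1 hxη).trans_lt <|
        (lt_add_one η).trans_le (Real.le_coe_toNNReal _)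
    have hlip := (lipschitzWith_setIntegral_add_smul hK hoff (u.norm_eq_one 1)
      MeasurableSet.univ).comp (isometry_add_smul (u.norm_eq_one 0) z).lipschitz
    simp only [setIntegral_univ] at hlip
    exact ⟨_, hlip⟩
  eq_off s hs := integral_eq_zero_of_ae <| .of_forall fun v => hb.eq_off _ fun hmem => hs <| by
    have h01 : inner ℝ (u 0) (u 1) = 0 := u.orthonormal.2 (by decide)
    have hle := (abs_inner_sub_le_dist (u.norm_eq_one 0) _ z).trans (mem_closedBall.1 hmem)
    simpa [add_assoc, inner_add_right, inner_smul_right, h01] using hle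

theorem integral_crossProfile_pos (u : OrthonormalBasis (Fin 2) ℝ E)
    (hb : IsBump b (closedBall z η)) (hbz : b z ≠ 0) : 0 < ∫ s, crossProfile u z b s := by
  have := u.toBasis.finiteDimensional_of_finite
  have := FiniteDimensional.proper ℝ E
  have hline := isometry_add_smul (u.norm_eq_one 1) z
  have hpos : 0 < ∫ v : ℝ, b (z + v • u 1) :=
    (hb.continuous.comp hline.continuous).integral_pos_of_hasCompactSupport_nonneg_nonzero
      ((hb.hasCompactSupport isBounded_closedBall).comp_isClosedEmbedding hline.isClosedEmbedding)
      (fun v => hb.nonneg _) (x := 0) (by simpa using hbz)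
  refine (isBump_crossProfile u hb).integral_pos isBounded_closedBall (s := 0) ?_
  simpa [crossProfile] using hpos.ne'

variable [MeasurableSpace E] [BorelSpace E]

theorem exists_exchangeable_bump (μ : Measure E) [μ.IsAddHaarMeasure]
    (hE : Module.finrank ℝ E = 2) {p q : E} {b c : E → ℝ} (hη : 0 < η)
    (hb : IsBump b (closedBall q η)) (hc : IsBump c (closedBall p η)) (hcp : c p ≠ 0) :
    ∃ κ : ℝ≥0, ∀ A, ∃ k, Exchangeable μ (IsBackground A)
      (cthickening (2 * η) (segment ℝ p q)) k b fun x => κ * c x := by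
  have := Module.finite_of_finrank_eq_succ hE
  have := FiniteDimensional.proper ℝ E
  obtain ⟨u, hu⟩ := exists_orthonormalBasis_inner_eq_zero hE (q - p)
  obtain ⟨χ, hχ, hχ1⟩ := exists_isBump_integral_eq_one hη
  have hprofb := isBump_crossProfile u hb
  have hprofc := isBump_crossProfile u hc
  have hmass := integral_crossProfile_pos u hc hcp
  obtain ⟨κ, hκ⟩ : ∃ κ : ℝ≥0, ∫ s, crossProfile u q b s = κ * ∫ s, crossProfile u p c s :=
    ⟨⟨_, div_nonneg (integral_nonneg hprofb.nonneg) hmass.le⟩, (div_mul_cancel₀ _ hmass.ne').symm⟩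
  set Q := cthickening (2 * η) (segment ℝ p q)
  have hQ : Convex ℝ Q := (convex_segment p q).cthickening _
  have hQb : Bornology.IsBounded Q := by
    refine Bornology.IsBounded.cthickening ?_
    rw [← convexHull_pair, isBounded_convexHull]
    exact (toFinite {p, q}).isBounded
  have hpQ : closedBall p (2 * η) ⊆ Q :=
    closedBall_subset_cthickening (left_mem_segment ℝ p q) _
  have hqQ : closedBall q (2 * η) ⊆ Q :=
    closedBall_subset_cthickening (right_mem_segment ℝ p q) _
  have hηQ (z : E) : closedBall z η ⊆ closedBall z (2 * η) :=
    closedBall_subset_closedBall (by linarith)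
  have hPb := (isBump_productBump (u := u) (z := q) hprofb hχ).mono hqQ
  have hPc := ((isBump_productBump (u := u) (z := p) hprofc hχ).mono hpQ).const_mul κ
  choose k₁ h₁ using exists_exchangeable_of_integral_eq μ (u.norm_eq_one 1) hQ hQb
    (hb.mono ((hηQ q).trans hqQ)) hPb (fun x => by
      rw [integral_add_smul_one u q, integral_productBump_add_smul_one, hχ1, mul_one])
  choose k₂ h₂ using exists_exchangeable_of_integral_eq μ (u.norm_eq_one 0) hQ hQb hPb hPc
    (fun x => by
      rw [integral_const_mul, integral_productBump_add_smul_zero,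
        integral_productBump_add_smul_zero, hκ, mul_assoc, ← sub_add_sub_cancel x q p,
        inner_add_right, hu, add_zero])
  choose k₃ h₃ using exists_exchangeable_of_integral_eq μ (u.norm_eq_one 1) hQ hQb hPc
    ((hc.mono ((hηQ p).trans hpQ)).const_mul κ) (fun x => by
      rw [integral_const_mul, integral_const_mul, integral_add_smul_one u p c,
        integral_productBump_add_smul_one, hχ1, mul_one])
  exact ⟨κ, fun A => ⟨_, ((h₁ A).trans (h₂ A)).trans (h₃ A)⟩⟩

end ProductBump

/-! ### Concentrating, moving and spreading the excess mass -/

theorem IsBackground.sum {X ι : Type*} [PseudoMetricSpace X] {s : Finset ι} {d : ι → X → ℝ}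
    {a L : ι → ℝ≥0} {A ε : ℝ≥0} (hd : ∀ i x, 0 ≤ d i x) (hL : ∀ i, LipschitzWith (L i) (d i))
    (ha : ∀ i, a i ≤ ε) (hA : ∑ i ∈ s, L i ≤ A) :
    IsBackground A ε fun x => ∑ i ∈ s, a i * d i x where
  nonneg x := Finset.sum_nonneg fun i _ => mul_nonneg (a i).coe_nonneg (hd i x)
  lipschitzWith := LipschitzWith.of_dist_le_mul fun x y =>
    calc dist (∑ i ∈ s, a i * d i x) (∑ i ∈ s, a i * d i y)
        ≤ ∑ i ∈ s, dist (a i * d i x) (a i * d i y) := dist_sum_sum_le _ _ _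
      _ ≤ ∑ i ∈ s, ε * (L i * dist x y) := by
        gcongr with i
        rw [Real.dist_eq, ← mul_sub, abs_mul, NNReal.abs_eq]
        gcongr
        exacts [ha i, (hL i).dist_le_mul x y]
      _ = (∑ i ∈ s, L i : ℝ≥0) * ε * dist x y := by
        push_cast
        simp_rw [← Finset.mul_sum, ← Finset.sum_mul]
        ring
      _ ≤ (A * ε : ℝ≥0) * dist x y := by
        push_cast
        gcongr
        exact_mod_cast hA

section Haar

variable {ι E : Type*} [Fintype ι] [NormedAddCommGroup E] [NormedSpace ℝ E] [FiniteDimensional ℝ E]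
  [MeasurableSpace E] [BorelSpace E] {μ : Measure E} [μ.IsAddHaarMeasure] {U : Set E}

theorem Exchangeable.sum [DecidableEq ι] {H : ι → ℝ≥0 → (E → ℝ) → Prop} {k : ι → ℝ}
    {b c : ι → E → ℝ} (h : ∀ i, Exchangeable μ (H i) U (k i) (b i) (c i)) {ε : ℝ≥0} {a : ι → ℝ≥0}
    (ha : ∀ i, a i ≤ ε)
    (hH : ∀ i (S : Finset ι), H i ε fun x => ∑ j ∈ Finset.univ.erase i, a j * S.piecewise c b j x) :
    Transportable μ U ((1 + ε) ^ ∑ i, k i) (fun x => 1 + ∑ j, a j * b j x)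
      fun x => 1 + ∑ j, a j * c j x := by
  suffices hS : ∀ S : Finset ι, Transportable μ U ((1 + ε) ^ ∑ i ∈ S, k i)
      (fun x => 1 + ∑ j, a j * b j x) fun x => 1 + ∑ j, a j * S.piecewise c b j x by
    simpa using hS Finset.univ
  intro S
  induction S using Finset.induction_on with
  | empty => simpa using Transportable.refl μ U _
  | insert i S hi ih =>
    rw [Finset.sum_insert hi, add_comm (k i)]
    refine ih.trans_rpow ?_
    convert h i ε (a i) (ha i) _ (hH i S) using 2 with x x
    · rw [← Finset.sum_erase_add _ _ (Finset.mem_univ i), Finset.piecewise_eq_of_notMem _ _ _ hi,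
        add_assoc]
    · rw [← Finset.sum_erase_add _ _ (Finset.mem_univ i),
        Finset.piecewise_eq_of_mem _ _ _ (Finset.mem_insert_self i S), add_assoc]
      congr 2
      refine Finset.sum_congr rfl fun j hj => ?_
      rw [Finset.piecewise_insert_of_ne _ _ _ (Finset.ne_of_mem_erase hj)]

end Haar

theorem gaugeBump_eq_zero {E : Type*} {g : E → ℝ} {l : ℝ} {x : E} (hl : 0 < l) (hx : l ≤ g x) :
    gaugeBump g l x = 0 := by
  rw [gaugeBump, bumpProfile_eq_zero ((one_le_div hl).2 hx), zero_div]

namespace IsRadialGauge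

section Bump

variable {E : Type*} [NormedAddCommGroup E] [NormedSpace ℝ E] {g : E → ℝ} {p : E} {K R l : ℝ≥0}

theorem gaugeBump_center_ne_zero (hg : IsRadialGauge g p K R) (hl : 0 < l) :
    gaugeBump g l p ≠ 0 := by
  simp [gaugeBump, bumpProfile, hg.map_center, hl.ne']

theorem isBump_gaugeBump (hg : IsRadialGauge g p K R) (hl : 0 < l) :
    IsBump (gaugeBump g l) (closedBall p (R * l)) where
  nonneg x := div_nonneg (bumpProfile_nonneg (div_nonneg (hg.nonneg x) l.coe_nonneg)) (sq_nonneg _)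
  exists_lipschitzWith := by
    have hdiv := (lipschitzWith_smul ((l : ℝ)⁻¹)).comp hg.lipschitz
    have hprof := lipschitzOnWith_bumpProfile.comp (hdiv.lipschitzOnWith (s := univ))
      fun x _ => mul_nonneg (inv_nonneg.2 l.coe_nonneg) (hg.nonneg x)
    have hscaled := (lipschitzWith_smul ((l : ℝ) ^ 2)⁻¹).comp (lipschitzOnWith_univ.1 hprof)
    have heq : gaugeBump g l = fun x => ((l : ℝ) ^ 2)⁻¹ * bumpProfile ((l : ℝ)⁻¹ * g x) := by
      ext x
      rw [gaugeBump, div_eq_inv_mul, div_eq_inv_mul]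
    rw [heq]
    exact ⟨_, hscaled⟩
  eq_off x hx := gaugeBump_eq_zero (NNReal.coe_pos.2 hl) <| le_of_not_gt fun h =>
    hx <| mem_closedBall.2 <| (hg.dist_le x).trans (by gcongr)

theorem exists_isBump_gaugeBump (hg : IsRadialGauge g p K R) {η : ℝ} (hη : 0 < η) :
    ∃ l : ℝ≥0, 0 < l ∧ l < 1 ∧ IsBump (gaugeBump g l) (closedBall p η) := by
  lift η to ℝ≥0 using hη.le
  have hl : 0 < min (1 / 2) (η / (R + 1)) :=
    lt_min one_half_pos (div_pos (mod_cast hη) (by positivity))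
  refine ⟨_, hl, (min_le_left _ _).trans_lt one_half_lt_one,
    (hg.isBump_gaugeBump hl).mono (closedBall_subset_closedBall ?_)⟩
  norm_cast
  calc R * min (1 / 2) (η / (R + 1)) ≤ (R + 1) * (η / (R + 1)) := by
        gcongr
        exacts [le_self_add, min_le_right _ _]
    _ = η := by field_simp

theorem segment_subset_lt (hg : IsRadialGauge g p K R) {q : E} (hq : g q < 1) :
    segment ℝ p q ⊆ {x | g x < 1} := by
  rw [segment_eq_image']
  rintro _ ⟨t, ht, rfl⟩
  rw [mem_ofPred_eq, hg.map_add_smul t ht.1, add_sub_cancel]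
  exact (mul_le_of_le_one_left (hg.nonneg q) ht.2).trans_lt hq

theorem exists_cthickening_segment_subset {ι : Type*} [Finite ι] (hg : IsRadialGauge g p K R)
    {ps : ι → E} (hps : ∀ i, g (ps i) < 1) :
    ∃ η : ℝ, 0 < η ∧ ∀ i, cthickening (2 * η) (segment ℝ p (ps i)) ⊆ {x | g x < 1} := by
  have hδ (i : ι) : ∃ δ : ℝ, 0 < δ ∧ cthickening δ (segment ℝ p (ps i)) ⊆ {x | g x < 1} := by
    refine IsCompact.exists_cthickening_subset_open ?_ hg.isOpen_lt (hg.segment_subset_lt (hps i))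
    rw [segment_eq_image']
    exact isCompact_Icc.image (by fun_prop)
  choose δ hδ hδU using hδ
  have hsmall : ∀ᶠ η in 𝓝[>] (0 : ℝ), ∀ i, 2 * η ≤ δ i := eventually_all.2 fun i =>
    nhdsWithin_le_nhds <| (eventually_le_nhds (half_pos (hδ i))).mono fun η hη => by linarith
  obtain ⟨η, hle, hη⟩ := (hsmall.and self_mem_nhdsWithin).exists
  exact ⟨η, hη, fun i => (cthickening_mono (hle i) _).trans (hδU i)⟩

end Bump

section Plane

variable {ι E : Type*} [NormedAddCommGroup E] [InnerProductSpace ℝ E]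
  [MeasurableSpace E] [BorelSpace E] {g : E → ℝ} {p : E} {K R l : ℝ≥0}
  {gs : ι → E → ℝ} {ps : ι → E} {Ks Rs : ι → ℝ≥0}

theorem exists_transportable_gaugeBump_indicator (μ : Measure E) [μ.IsAddHaarMeasure]
    (hE : Module.finrank ℝ E = 2) (hg : IsRadialGauge g p K R) (hl : 0 < l) (hl1 : l < 1) :
    ∃ C : ℝ≥0, ∀ (a : ℝ≥0) (h : E → ℝ), (∀ x, g x < 1 → h x = 0) →
      Transportable μ {x | g x < 1} (1 + C * a) (fun x => 1 + h x + a * gaugeBump g l x)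
        fun x => 1 + h x + (a : ℝ) * {y | g y < 1}.indicator 1 x := by
  have := Module.finite_of_finrank_eq_succ hE
  obtain ⟨C, hC⟩ := hg.exists_transportable_gaugeBump μ hE hl hl1
  refine ⟨C, fun a h hh => hC a _ _ (fun x hx => ?_) (fun x hx => ?_) fun x hx => ?_⟩
  · rw [hh x hx, add_zero]
  · rw [hh x hx, indicator_of_mem (by exact hx), add_zero, Pi.one_apply, mul_one]
  · rw [gaugeBump_eq_zero (NNReal.coe_pos.2 hl) ((NNReal.coe_lt_one.2 hl1).trans hx).le,
      indicator_of_notMem (by exact hx.not_gt)]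

theorem exists_exchangeable_indicator_gaugeBump (μ : Measure E) [μ.IsAddHaarMeasure]
    (hE : Module.finrank ℝ E = 2) (hg : IsRadialGauge g p K R) (hl : 0 < l) (hl1 : l < 1) :
    ∃ k, Exchangeable μ (fun _ h => ∀ x, g x < 1 → h x = 0) {x | g x < 1} k
      ({x | g x < 1}.indicator 1) (gaugeBump g l) := by
  have := Module.finite_of_finrank_eq_succ hE
  obtain ⟨C, hC⟩ := hg.exists_transportable_gaugeBump_indicator μ hE hl hl1
  refine ⟨max C 1, fun ε a ha h hh => (hC a h hh).symm.mono ?_ subset_rfl⟩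
  grw [ha]
  exact one_add_mul_le_rpow C ε

variable [Fintype ι]

theorem exists_transportable_concentrate (μ : Measure E) [μ.IsAddHaarMeasure]
    (hE : Module.finrank ℝ E = 2) (hgs : ∀ i, IsRadialGauge (gs i) (ps i) (Ks i) (Rs i))
    (hdisj : ∀ i j, i ≠ j → ∀ x, gs i x < 1 → 1 ≤ gs j x) {ls : ι → ℝ≥0} (hls : ∀ i, 0 < ls i)
    (hls1 : ∀ i, ls i < 1) {U : Set E} (hU : ∀ i, {x | gs i x < 1} ⊆ U) :
    ∃ k : ℝ, ∀ (ε : ℝ≥0) (a : ι → ℝ≥0), (∀ i, a i ≤ ε) →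
      Transportable μ U ((1 + ε) ^ k) (fun x => 1 + ∑ j, (a j : ℝ) * {y | gs j y < 1}.indicator 1 x)
        fun x => 1 + ∑ j, a j * gaugeBump (gs j) (ls j) x := by
  classical
  have := Module.finite_of_finrank_eq_succ hE
  choose k hk using fun i =>
    (hgs i).exists_exchangeable_indicator_gaugeBump μ hE (hls i) (hls1 i)
  refine ⟨∑ i, k i, fun ε a ha => Exchangeable.sum (fun i => (hk i).mono (fun _ _ h => h) (hU i)) ha
    fun i S x hx => Finset.sum_eq_zero fun j hj => ?_⟩
  have hj1 : 1 ≤ gs j x := hdisj i j (Finset.ne_of_mem_erase hj).symm x hx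
  have hbump : gaugeBump (gs j) (ls j) x = 0 :=
    gaugeBump_eq_zero (NNReal.coe_pos.2 (hls j)) ((NNReal.coe_lt_one.2 (hls1 j)).le.trans hj1)
  have hind : {y | gs j y < 1}.indicator (1 : E → ℝ) x = 0 :=
    indicator_of_notMem (by exact hj1.not_gt) _
  by_cases hjS : j ∈ S <;> simp [hjS, hbump, hind]

theorem exists_transportable_spread (μ : Measure E) [μ.IsAddHaarMeasure]
    (hE : Module.finrank ℝ E = 2) (hg : IsRadialGauge g p K R) (hl : 0 < l) (hl1 : l < 1)
    (B : ℝ≥0) :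
    ∃ k : ℝ, ∀ ε b : ℝ≥0, b ≤ B * ε →
      Transportable μ {x | g x < 1} ((1 + ε) ^ k) (fun x => 1 + b * gaugeBump g l x)
        fun x => 1 + (b : ℝ) * {y | g y < 1}.indicator 1 x := by
  have := Module.finite_of_finrank_eq_succ hE
  obtain ⟨C, hC⟩ := hg.exists_transportable_gaugeBump_indicator μ hE hl hl1
  refine ⟨max (C * B : ℝ≥0) 1, fun ε b hb => ?_⟩
  have hspread := hC b 0 fun x _ => rfl
  simp only [Pi.zero_apply, add_zero] at hspread
  refine hspread.mono ?_ subset_rfl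
  grw [hb, ← mul_assoc]
  exact one_add_mul_le_rpow (C * B) ε

end Plane

end IsRadialGauge

section Gather

variable {ι E : Type*} [Fintype ι] [NormedAddCommGroup E] [InnerProductSpace ℝ E]
  [MeasurableSpace E] [BorelSpace E] {b : ι → E → ℝ} {c : E → ℝ} {p : E} {ps : ι → E} {η : ℝ}

theorem exists_transportable_gather (μ : Measure E) [μ.IsAddHaarMeasure]
    (hE : Module.finrank ℝ E = 2) (hη : 0 < η) (hb : ∀ i, IsBump (b i) (closedBall (ps i) η))
    (hc : IsBump c (closedBall p η)) (hcp : c p ≠ 0) {U : Set E}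
    (hU : ∀ i, cthickening (2 * η) (segment ℝ p (ps i)) ⊆ U) :
    ∃ (κ : ι → ℝ≥0) (k : ℝ), ∀ (ε : ℝ≥0) (a : ι → ℝ≥0), (∀ i, a i ≤ ε) →
      Transportable μ U ((1 + ε) ^ k) (fun x => 1 + ∑ j, a j * b j x)
        fun x => 1 + ∑ j, a j * (κ j * c x) := by
  classical
  have := Module.finite_of_finrank_eq_succ hE
  choose κ hκ using fun i => exists_exchangeable_bump μ hE hη (hb i) hc hcp
  choose L hL using fun i => (hb i).exists_lipschitzWith
  choose M hM using fun i => (hc.const_mul (κ i)).exists_lipschitzWith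
  choose k hk using fun i => hκ i (∑ j, max (L j) (M j))
  refine ⟨κ, ∑ i, k i, fun ε a ha => Exchangeable.sum
    (fun i => (hk i).mono (fun _ _ h => h) (hU i)) ha fun i S =>
    .sum (fun j x => ?_) (fun j => ?_) ha (Finset.sum_le_univ_sum_of_nonneg fun _ => zero_le)⟩
  · by_cases hj : j ∈ S
    · simpa [hj] using (hc.const_mul (κ j)).nonneg x
    · simpa [hj] using (hb j).nonneg x
  · by_cases hj : j ∈ S
    · simpa [hj] using (hM j).weaken (le_max_right (L j) _)
    · simpa [hj] using (hL j).weaken (le_max_left _ (M j))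

theorem exists_transportable_indicator (μ : Measure E) [μ.IsAddHaarMeasure]
    (hE : Module.finrank ℝ E = 2) {g : E → ℝ} {K R : ℝ≥0} {gs : ι → E → ℝ} {Ks Rs : ι → ℝ≥0}
    (hg : IsRadialGauge g p K R) (hgs : ∀ i, IsRadialGauge (gs i) (ps i) (Ks i) (Rs i))
    (hsub : ∀ i, {x | gs i x < 1} ⊆ {x | g x < 1})
    (hdisj : ∀ i j, i ≠ j → ∀ x, gs i x < 1 → 1 ≤ gs j x) :
    ∃ k : ℝ, ∀ (ε : ℝ≥0) (a : ι → ℝ≥0), (∀ i, a i ≤ ε) → ∃ b : ℝ≥0,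
      Transportable μ {x | g x < 1} ((1 + ε) ^ k)
        (fun x => 1 + ∑ j, (a j : ℝ) * {y | gs j y < 1}.indicator 1 x)
        fun x => 1 + (b : ℝ) * {y | g y < 1}.indicator 1 x := by
  have := Module.finite_of_finrank_eq_succ hE
  have hps (i : ι) : g (ps i) < 1 := hsub i (by simp [(hgs i).map_center])
  obtain ⟨η, hη, hηU⟩ := hg.exists_cthickening_segment_subset hps
  obtain ⟨l, hl, hl1, hc⟩ := hg.exists_isBump_gaugeBump hη
  choose ls hls hls1 hb using fun i => (hgs i).exists_isBump_gaugeBump hη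
  obtain ⟨k₁, hconc⟩ := IsRadialGauge.exists_transportable_concentrate μ hE hgs hdisj hls hls1 hsub
  obtain ⟨κ, k₂, hgather⟩ := exists_transportable_gather μ hE hη hb hc
    (hg.gaugeBump_center_ne_zero hl) hηU
  obtain ⟨k₃, hspread⟩ := hg.exists_transportable_spread μ hE hl hl1 (∑ j, κ j)
  refine ⟨k₁ + k₂ + k₃, fun ε a ha => ⟨∑ j, a j * κ j,
    ((hconc ε a ha).trans_rpow ?_).trans_rpow (hspread ε _ ?_)⟩⟩
  · convert hgather ε a ha using 2 with x
    push_cast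
    simp_rw [Finset.sum_mul, mul_assoc]
  · rw [Finset.sum_mul]
    refine Finset.sum_le_sum fun j _ => ?_
    rw [mul_comm (κ j)]
    gcongr
    exact ha j

end Gather

/-! ### The transported density determines the determinant -/

namespace IsTransport

section Haar

variable {E : Type*} [NormedAddCommGroup E] [NormedSpace ℝ E] [MeasurableSpace E] {μ : Measure E}
  {φ : E ≃ E} {U S : Set E} {L : ℝ≥0} {ρ ρ' : E → ℝ}

theorem mapsTo (h : IsTransport μ φ U L ρ ρ') (hS : U ⊆ S) : MapsTo φ S S := fun x hx => by
  by_contra hφx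
  have hfix := φ.injective (h.eq_off (φ x) fun hU => hφx (hS hU))
  exact hφx (hfix.symm ▸ hx)

theorem bijOn (h : IsTransport μ φ U L ρ ρ') (hS : U ⊆ S) : BijOn φ S S := by
  refine ⟨h.mapsTo hS, φ.injective.injOn, fun y hy => ⟨φ.symm y, ?_, φ.apply_symm_apply y⟩⟩
  by_contra hsymm
  have hfix := h.eq_off (φ.symm y) fun hU => hsymm (hS hU)
  rw [φ.apply_symm_apply] at hfix
  exact hsymm (hfix ▸ hy)

variable [FiniteDimensional ℝ E] [BorelSpace E] [μ.IsAddHaarMeasure]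

theorem setIntegral_abs_det (h : IsTransport μ φ U L ρ ρ') (hUS : U ⊆ S) (hS : MeasurableSet S) :
    ∫ x in S, |(fderiv ℝ φ x).det| ∂μ = μ.real S := by
  set D := {x | DifferentiableAt ℝ φ x}
  have hD : ∀ᵐ x ∂μ, x ∈ D := h.jac.mono fun x hx => hx.1
  have hSD : (S ∩ D : Set E) =ᵐ[μ] S := inter_ae_eq_left_of_ae_eq_univ (eventuallyEq_univ.2 hD)
  have himage : (φ '' (S ∩ D) : Set E) =ᵐ[μ] S := by
    have hsymm := quasiMeasurePreserving_of_lipschitzWith_symm (μ := μ) (φ := φ.symm)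
      h.lipschitz_symm.continuous.measurable h.lipschitz
    rw [image_inter φ.injective, (h.bijOn hUS).image_eq, φ.image_eq_preimage_symm]
    exact inter_ae_eq_left_of_ae_eq_univ (eventuallyEq_univ.2 (hsymm.ae hD))
  have hchange := integral_image_eq_integral_abs_det_fderiv_smul μ
    (hS.inter (measurableSet_of_differentiableAt ℝ φ))
    (fun x hx => hx.2.hasFDerivAt.hasFDerivWithinAt) φ.injective.injOn fun _ => (1 : ℝ)
  rw [setIntegral_congr_set himage, setIntegral_congr_set hSD] at hchange
  simpa using hchange.symm

theorem ae_det_eq (h : IsTransport μ φ U L ρ ρ') (hUS : U ⊆ S) (hS : MeasurableSet S)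
    (hμS : μ.real S ≠ 0) {F : ℝ} (hF : 0 < F) {f : E → ℝ} (hf : ∀ x ∈ S, 0 ≤ f x)
    (hdet : ∀ᵐ x ∂μ.restrict S, F * (fderiv ℝ φ x).det = f x) :
    ∀ᵐ x ∂μ.restrict S, (fderiv ℝ φ x).det = μ.real S / (∫ y in S, f y ∂μ) * f x := by
  have hinteg : ∫ y in S, f y ∂μ = F * μ.real S := by
    rw [← h.setIntegral_abs_det hUS hS, ← integral_const_mul]
    refine integral_congr_ae ?_
    filter_upwards [hdet, ae_restrict_mem hS] with x hx hxS
    rw [← abs_of_nonneg (hf x hxS), ← hx, abs_mul, abs_of_pos hF]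
  filter_upwards [hdet] with x hx
  rw [hinteg, ← hx]
  field_simp

end Haar

theorem isBiLipSelfMap {μ : Measure Plane} {φ : Plane ≃ Plane} {U T : Set Plane} {L : ℝ≥0}
    {ρ ρ' : Plane → ℝ} (h : IsTransport μ φ U L ρ ρ') (hUT : U ⊆ T) : IsBiLipSelfMap L φ T where
  bijOn := h.bijOn hUT
  upper x _ y _ := h.lipschitz.dist_le_mul x y
  lower x _ y _ := by simpa using h.lipschitz_symm.dist_le_mul (φ x) (φ y)

end IsTransport

/-! ### Piecewise constant densities on a tiling -/

theorem exists_relative_excess {ι : Type*} [Finite ι] [Nonempty ι] {v : ι → ℝ}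
    (hv : ∀ i, 0 < v i) :
    ∃ (m : ℝ) (ε : ℝ≥0) (a : ι → ℝ≥0), 0 < m ∧ (∀ i, a i ≤ ε) ∧ (∀ i, v i = m * (1 + a i)) ∧
      sSup (range v) / sInf (range v) = 1 + ε := by
  have hfin : (range v).Finite := finite_range v
  obtain ⟨i, hi⟩ := (range_nonempty v).csInf_mem hfin
  set m := sInf (range v)
  have hm : 0 < m := hi ▸ hv i
  have hmv (i : ι) : m ≤ v i := csInf_le hfin.bddBelow (mem_range_self i)
  have hvM (i : ι) : v i ≤ sSup (range v) := le_csSup hfin.bddAbove (mem_range_self i)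
  have hexcess {t : ℝ} (ht : m ≤ t) : ((t / m - 1).toNNReal : ℝ) = t / m - 1 :=
    Real.coe_toNNReal _ (sub_nonneg.2 ((one_le_div hm).2 ht))
  refine ⟨m, (sSup (range v) / m - 1).toNNReal, fun i => (v i / m - 1).toNNReal, hm,
    fun i => ?_, fun i => ?_, ?_⟩
  · exact Real.toNNReal_le_toNNReal (by gcongr; exact hvM i)
  · rw [hexcess (hmv i)]
    field_simp
    ring
  · rw [hexcess ((hmv i).trans (hvM i)), add_sub_cancel]

theorem IsStarDomain.volume_real_ne_zero {T : Set Plane} {p : Plane} (hT : IsStarDomain T p) :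
    volume.real T ≠ 0 :=
  ENNReal.toReal_ne_zero.2
    ⟨(Measure.measure_pos_of_mem_nhds volume (mem_interior_iff_mem_nhds.1 hT.mem_interior)).ne',
      hT.isCompact.measure_ne_top⟩

namespace IsTilingOf

variable {n : ℕ} {T : Set Plane} {p : Plane} {Ti : Fin n → Set Plane} {pt : Fin n → Plane}

theorem subset (hpart : IsTilingOf T Ti) (i : Fin n) : Ti i ⊆ T :=
  hpart.iUnion_eq ▸ subset_iUnion Ti i

theorem nonempty_index (hpart : IsTilingOf T Ti) (hT : T.Nonempty) : Nonempty (Fin n) := by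
  rw [← hpart.iUnion_eq, nonempty_iUnion] at hT
  exact hT.nonempty

theorem sum_mul_indicator (hpart : IsTilingOf T Ti) (a : Fin n → ℝ) {i : Fin n} {x : Plane}
    (hx : x ∈ interior (Ti i)) : ∑ j, a j * (interior (Ti j)).indicator 1 x = a i := by
  rw [Finset.sum_eq_single i _ (by simp), indicator_of_mem hx, Pi.one_apply, mul_one]
  intro j _ hji
  rw [indicator_of_notMem, mul_zero]
  exact (hpart.disjoint_interior i j hji.symm).notMem_of_mem_left hx

theorem ae_exists_mem_interior (hpart : IsTilingOf T Ti) (hT : MeasurableSet T)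
    (hfr : ∀ i, volume (frontier (Ti i)) = 0) :
    ∀ᵐ x ∂volume.restrict T, ∃ i, x ∈ interior (Ti i) := by
  have hoff : ∀ᵐ x, ∀ i, x ∉ frontier (Ti i) :=
    ae_all_iff.2 fun i => measure_eq_zero_iff_ae_notMem.1 (hfr i)
  filter_upwards [ae_restrict_of_ae hoff, ae_restrict_mem hT] with x hx hxT
  obtain ⟨i, hi⟩ := mem_iUnion.1 (hpart.iUnion_eq.ge hxT)
  exact ⟨i, by_contra fun h => hx i ⟨subset_closure hi, h⟩⟩

theorem exists_transportable (hpart : IsTilingOf T Ti) (hT : IsStarDomain T p)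
    (hTi : ∀ i, IsStarDomain (Ti i) (pt i)) :
    ∃ k : ℝ, ∀ (ε : ℝ≥0) (a : Fin n → ℝ≥0), (∀ i, a i ≤ ε) → ∃ b : ℝ≥0,
      Transportable volume (interior T) ((1 + ε) ^ k)
        (fun x => 1 + ∑ j, (a j : ℝ) * (interior (Ti j)).indicator 1 x)
        fun x => 1 + (b : ℝ) * (interior T).indicator 1 x := by
  obtain ⟨K, R, hg⟩ := hT.exists_isRadialGauge
  choose Ks Rs hgs using fun i => (hTi i).exists_isRadialGauge
  have hlt (i : Fin n) := (hTi i).setOf_starGauge_lt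
  have hmain := exists_transportable_indicator volume finrank_euclideanSpace_fin hg hgs
  simp only [hT.setOf_starGauge_lt, hlt] at hmain
  refine hmain (fun i => interior_mono (hpart.subset i)) fun i j hij x hx => ?_
  by_contra! hxj
  exact (hpart.disjoint_interior i j hij).notMem_of_mem_left ((hlt i).le hx) ((hlt j).le hxj)

theorem ae_one_add_mul_det_eq (hpart : IsTilingOf T Ti) (hT : MeasurableSet T)
    (hfr : ∀ i, volume (frontier (Ti i)) = 0) {φ : Plane ≃ Plane} {L : ℝ≥0} {a : Fin n → ℝ} {b : ℝ}
    (hφ : IsTransport volume φ (interior T) L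
      (fun x => 1 + ∑ j, a j * (interior (Ti j)).indicator 1 x)
      fun x => 1 + b * (interior T).indicator 1 x) :
    ∀ᵐ x ∂volume.restrict T,
      ∃ i, x ∈ interior (Ti i) ∧ (1 + b) * (fderiv ℝ φ x).det = 1 + a i := by
  filter_upwards [ae_restrict_of_ae hφ.jac, hpart.ae_exists_mem_interior hT hfr]
    with x ⟨_, hjac⟩ ⟨i, hi⟩
  have hφx : φ x ∈ interior T := hφ.mapsTo subset_rfl (interior_mono (hpart.subset i) hi)
  rw [hpart.sum_mul_indicator a hi, indicator_of_mem hφx, Pi.one_apply, mul_one, mul_comm] at hjac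
  exact ⟨i, hi, hjac⟩

end IsTilingOf

theorem image_iUnion_eq_range {α β ι : Type*} {f : α → β} {S : ι → Set α} {v : ι → β}
    (hS : ∀ i, (S i).Nonempty) (hf : ∀ i, ∀ x ∈ S i, f x = v i) : f '' ⋃ i, S i = range v := by
  ext y
  simp only [mem_image, mem_iUnion, mem_range]
  constructor
  · rintro ⟨x, ⟨i, hx⟩, rfl⟩
    exact ⟨i, (hf i x hx).symm⟩
  · rintro ⟨i, rfl⟩
    obtain ⟨x, hx⟩ := hS i
    exact ⟨x, ⟨i, hx⟩, hf i x hx⟩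

theorem proposition3p2 (T : Set Plane) (p : Plane) (hT : IsStarDomain T p)
    (n : ℕ) (Ti : Fin n → Set Plane) (pt : Fin n → Plane)
    (hTi : ∀ i, IsStarDomain (Ti i) (pt i)) (hpart : IsTilingOf T Ti) :
    ∃ C₁ : ℝ, ∀ f : Plane → ℝ, (∀ x ∈ T, 0 < f x) →
      (∀ i, ∃ c : ℝ, ∀ x ∈ interior (Ti i), f x = c) →
      ∃ φ : Plane → Plane,
        IsBiLipSelfMap
          ((sSup (f '' ⋃ i, interior (Ti i)) / sInf (f '' ⋃ i, interior (Ti i))) ^ C₁) φ T ∧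
        (∀ x ∈ frontier T, φ x = x) ∧
        ∀ᵐ x ∂(volume.restrict T), DifferentiableAt ℝ φ x ∧
          (fderiv ℝ φ x).det = volume.real T / (∫ y in T, f y) * f x := by
  have := hpart.nonempty_index ⟨p, interior_subset hT.mem_interior⟩
  have hTm : MeasurableSet T := hT.isCompact.measurableSet
  obtain ⟨C₁, htransport⟩ := hpart.exists_transportable hT hTi
  refine ⟨C₁, fun f hf hconst => ?_⟩
  choose v hv using hconst
  have hvpos (i : Fin n) : 0 < v i :=
    hv i _ (hTi i).mem_interior ▸ hf _ (hpart.subset i (interior_subset (hTi i).mem_interior))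
  obtain ⟨m, ε, a, hm, haε, hva, hratio⟩ := exists_relative_excess hvpos
  obtain ⟨b, φ, hφ⟩ := htransport ε a haε
  have hdet : ∀ᵐ x ∂volume.restrict T, m * (1 + b) * (fderiv ℝ φ x).det = f x := by
    filter_upwards [hpart.ae_one_add_mul_det_eq hTm (fun i => (hTi i).volume_frontier) hφ]
      with x ⟨i, hi, hdet⟩
    rw [hv i x hi, hva i, ← hdet, mul_assoc]
  rw [image_iUnion_eq_range (fun i => ⟨pt i, (hTi i).mem_interior⟩) hv, hratio]
  refine ⟨φ, ?_, fun x hx => hφ.eq_off x hx.2, ?_⟩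
  · exact_mod_cast hφ.isBiLipSelfMap interior_subset
  filter_upwards [ae_restrict_of_ae hφ.jac, hφ.ae_det_eq interior_subset hTm hT.volume_real_ne_zero
    (F := m * (1 + b)) (by positivity) (fun x hx => (hf x hx).le) hdet] with x hx hxdet
  exact ⟨hx.1, hxdet⟩
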